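/- Let $R$ be a commutative $\mathbb{C}$-algebra, let $q\in R$ be invertible, let $m,n\ge 1$ be integers and let $v_1,\dots,v_m\in R$ (for example $R=\mathbb{C}[q,q^{-1},v_1,\dots,v_m]$ with $q,v_1,\dots,v_m$ indeterminates, or $R=\mathbb{C}$ with numerical parameters). The cyclotomic Hecke algebra $H(m,1,n)$ is the associative unital $R$-algebra generated by $\tau,\sigma_1,\dots,\sigma_{n-1}$ with the defining relations $$\sigma_i\sigma_{i+1}\sigma_i=\sigma_{i+1}\sigma_i\sigma_{i+1}\ (1\le i\le n-2),\qquad \sigma_i\sigma_j=\sigma_j\sigma_i\ (|i-j|>1),$$ $$\tau\sigma_1\tau\sigma_1=\sigma_1\tau\sigma_1\tau,\qquad \tau\sigma_i=\sigma_i\tau\ (i>1),$$ $$\sigma_i^2=(q-q^{-1})\sigma_i+1\ (1\le i\le n-1),\qquad (\tau-v_1)\cdots(\tau-v_m)=0.$$ In particular each $\sigma_i$ is invertible, with $\sigma_i^{-1}=\sigma_i-(q-q^{-1})$. Let $\tilde W$ be the $R$-subalgebra of $H(m,1,n)$ generated by $\tau,\sigma_1,\dots,\sigma_{n-2}$ (for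 $n=2$ it is generated by $\tau$ alone, and for $n=1$ it is the subalgebra $R\cdot 1$ of scalars). Proposition. If $\tilde{\mathcal B}$ is a basis of $\tilde W$ as an $R$-module, then the elements $$\sigma_j^{-1}\sigma_{j-1}^{-1}\cdots\sigma_1^{-1}\,\tau^{\alpha}\,\sigma_1\sigma_2\cdots\sigma_{n-1}\,\tilde b,\qquad 0\le j\le n-1,\quad 0\le\alpha\le m-1,\quad \tilde b\in\tilde{\mathcal B},$$ form a basis of $H(m,1,n)$ as an $R$-module: the family indexed by the triples $(j,\alpha,\tilde b)$ is linearly independent over $R$ and spans $H(m,1,n)$. -/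

import Mathlib

namespace CyclotomicHecke

/-- The generators `τ, σ_1, …, σ_{n-1}` of `H(m,1,n)`; for `n = 0` there are none. -/
inductive Gen (n : ℕ) : Type
  | tau (h : 0 < n) : Gen n
  | sigma (i : ℕ) (h1 : 1 ≤ i) (h2 : i < n) : Gen n

section Free

variable (R : Type*) [CommRing R] {n : ℕ}

/-- `τ` in the free algebra. -/
abbrev freeTau (h : 0 < n) : FreeAlgebra R (Gen n) := FreeAlgebra.ι R (Gen.tau h)

/-- `σ_i` in the free algebra. -/
abbrev freeSigma (i : ℕ) (h1 : 1 ≤ i) (h2 : i < n) : FreeAlgebra R (Gen n) :=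
  FreeAlgebra.ι R (Gen.sigma i h1 h2)

end Free

/-- The defining relations of `H(m,1,n)` with parameters `q` and `v_1, …, v_m`. -/
inductive Rel {R : Type*} [CommRing R] (m n : ℕ) (q : Rˣ) (v : Fin m → R) :
    FreeAlgebra R (Gen n) → FreeAlgebra R (Gen n) → Prop
  /-- `σ_i σ_{i+1} σ_i = σ_{i+1} σ_i σ_{i+1}` for `1 ≤ i ≤ n - 2`. -/
  | braid (i : ℕ) (h1 : 1 ≤ i) (h2 : i + 1 < n) :
      Rel m n q v
        (freeSigma R i h1 (Nat.lt_of_succ_lt h2) * freeSigma R (i + 1) (Nat.le_add_left 1 i) h2 *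
          freeSigma R i h1 (Nat.lt_of_succ_lt h2))
        (freeSigma R (i + 1) (Nat.le_add_left 1 i) h2 * freeSigma R i h1 (Nat.lt_of_succ_lt h2) *
          freeSigma R (i + 1) (Nat.le_add_left 1 i) h2)
  /-- `σ_i σ_j = σ_j σ_i` for `|i - j| > 1`. -/
  | far (i j : ℕ) (hi1 : 1 ≤ i) (hi2 : i < n) (hj1 : 1 ≤ j) (hj2 : j < n)
      (hij : 1 < |(i : ℤ) - (j : ℤ)|) :
      Rel m n q v
        (freeSigma R i hi1 hi2 * freeSigma R j hj1 hj2)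
        (freeSigma R j hj1 hj2 * freeSigma R i hi1 hi2)
  /-- `τ σ_1 τ σ_1 = σ_1 τ σ_1 τ`. -/
  | tau_sigma_one (h0 : 0 < n) (h : 1 < n) :
      Rel m n q v
        (freeTau R h0 * freeSigma R 1 le_rfl h * freeTau R h0 * freeSigma R 1 le_rfl h)
        (freeSigma R 1 le_rfl h * freeTau R h0 * freeSigma R 1 le_rfl h * freeTau R h0)
  /-- `τ σ_i = σ_i τ` for `i > 1`. -/
  | tau_far (h0 : 0 < n) (i : ℕ) (h1 : 1 ≤ i) (h2 : i < n) (hi : 1 < i) :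
      Rel m n q v
        (freeTau R h0 * freeSigma R i h1 h2)
        (freeSigma R i h1 h2 * freeTau R h0)
  /-- `σ_i² = (q - q⁻¹) σ_i + 1`. -/
  | quadratic (i : ℕ) (h1 : 1 ≤ i) (h2 : i < n) :
      Rel m n q v
        (freeSigma R i h1 h2 ^ 2)
        (((q : R) - ((q⁻¹ : Rˣ) : R)) • freeSigma R i h1 h2 + 1)
  /-- `(τ - v_1) ⋯ (τ - v_m) = 0`. -/
  | cyclotomic (h0 : 0 < n) :
      Rel m n q v
        (List.ofFn fun k : Fin m => freeTau R h0 - algebraMap R (FreeAlgebra R (Gen n)) (v k)).prod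
        0

/-- The cyclotomic Hecke algebra `H(m,1,n)` over `R` with parameters `q` and `v_1, …, v_m`. -/
abbrev H {R : Type*} [CommRing R] (m n : ℕ) (q : Rˣ) (v : Fin m → R) : Type _ :=
  RingQuot (Rel m n q v)

section Elements

variable {R : Type*} [CommRing R] (m n : ℕ) (q : Rˣ) (v : Fin m → R)

/-- The generator `τ` of `H(m,1,n)`. -/
def tau (h : 0 < n) : H m n q v :=
  RingQuot.mkAlgHom R (Rel m n q v) (freeTau R h)

/-- The generator `σ_i` of `H(m,1,n)`, as an element. -/
def sigmaElt (i : ℕ) (h1 : 1 ≤ i) (h2 : i < n) : H m n q v :=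
  RingQuot.mkAlgHom R (Rel m n q v) (freeSigma R i h1 h2)

theorem sigmaElt_mul_self (i : ℕ) (h1 : 1 ≤ i) (h2 : i < n) :
    sigmaElt m n q v i h1 h2 * sigmaElt m n q v i h1 h2 =
      ((q : R) - ((q⁻¹ : Rˣ) : R)) • sigmaElt m n q v i h1 h2 + 1 := by
  have h := RingQuot.mkAlgHom_rel R (Rel.quadratic (m := m) (q := q) (v := v) i h1 h2)
  rw [map_pow, map_add, map_smul, map_one, pow_two] at h
  exact h

/-- The generator `σ_i` of `H(m,1,n)`, as a unit: by the quadratic relation its inverse is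
`σ_i - (q - q⁻¹)`. -/
def sigma (i : ℕ) (h1 : 1 ≤ i) (h2 : i < n) : (H m n q v)ˣ where
  val := sigmaElt m n q v i h1 h2
  inv := sigmaElt m n q v i h1 h2 - ((q : R) - ((q⁻¹ : Rˣ) : R)) • (1 : H m n q v)
  val_inv := by
    rw [mul_sub, sigmaElt_mul_self, mul_smul_comm, mul_one, add_sub_cancel_left]
  inv_val := by
    rw [sub_mul, sigmaElt_mul_self, smul_mul_assoc, one_mul, add_sub_cancel_left]

/-- In `H(m,1,n)` one has `(τ - v_1) ⋯ (τ - v_m) = 0`. -/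
theorem cyclotomic_tau (h : 0 < n) :
    (List.ofFn fun k : Fin m => tau m n q v h - algebraMap R (H m n q v) (v k)).prod = 0 := by
  have e := RingQuot.mkAlgHom_rel R (Rel.cyclotomic (m := m) (q := q) (v := v) h)
  rw [map_zero, map_list_prod, List.map_ofFn] at e
  rw [← e]
  congr 2
  funext k
  simp only [Function.comp_apply, map_sub, AlgHom.commutes, tau]

/-- When all the `v_k` are invertible, so is `τ`; in that case `H(m,1,n)` is a quotient of the
group algebra of the braid group of type B. -/
theorem isUnit_tau (hv : ∀ k, IsUnit (v k)) (h : 0 < n) : IsUnit (tau m n q v h) := by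
  classical
  set P : Polynomial R :=
    (List.ofFn fun k : Fin m => Polynomial.X - Polynomial.C (v k)).prod with hP
  have h1 : Polynomial.aeval (tau m n q v h) P = 0 := by
    rw [← cyclotomic_tau m n q v h, hP, map_list_prod, List.map_ofFn]
    congr 2
    funext k
    simp
  have h2 : IsUnit (P.coeff 0) := by
    rw [Polynomial.coeff_zero_eq_eval_zero, hP, List.prod_ofFn, Polynomial.eval_prod]
    refine IsUnit.prod_univ_iff.2 fun k => ?_
    simpa using (hv k).neg
  obtain ⟨u, hu⟩ := h2
  set Q : H m n q v := Polynomial.aeval (tau m n q v h) P.divX with hQ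
  have h3 : tau m n q v h * Q = -algebraMap R _ (u : R) := by
    have e := congrArg (Polynomial.aeval (tau m n q v h)) (Polynomial.X_mul_divX_add P)
    rw [h1, map_add, map_mul, Polynomial.aeval_X, Polynomial.aeval_C, ← hu] at e
    exact eq_neg_of_add_eq_zero_left e
  have h4 : Commute (tau m n q v h) Q := by
    have e := congrArg (Polynomial.aeval (tau m n q v h)) (Polynomial.X_mul (p := P.divX))
    rw [map_mul, map_mul, Polynomial.aeval_X] at e
    exact e
  have h5 : IsUnit (tau m n q v h * Q) := by
    rw [h3]
    exact (u.isUnit.map (algebraMap R (H m n q v))).neg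
  exact (h4.isUnit_mul_iff.1 h5).1

/-- The product `σ_1 σ_2 ⋯ σ_k`, for `k < n`. -/
def sigmaUp : (k : ℕ) → k < n → H m n q v
  | 0, _ => 1
  | k + 1, hk => sigmaUp k (Nat.lt_of_succ_lt hk) *
      (sigma m n q v (k + 1) (Nat.le_add_left 1 k) hk : H m n q v)

/-- The product `σ_j⁻¹ σ_{j-1}⁻¹ ⋯ σ_1⁻¹`, for `j < n`. -/
def sigmaInvDown : (j : ℕ) → j < n → H m n q v
  | 0, _ => 1
  | j + 1, hj => (((sigma m n q v (j + 1) (Nat.le_add_left 1 j) hj)⁻¹ : (H m n q v)ˣ) : H m n q v) *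
      sigmaInvDown j (Nat.lt_of_succ_lt hj)

/-- The subalgebra of `H(m,1,n)` generated by `τ, σ_1, …, σ_{n-2}`, that is, by the generators of
`H(m,1,n-1)`. For `n = 2` it is generated by `τ`, for `n = 1` by nothing. -/
def Wtilde : Subalgebra R (H m n q v) :=
  Algebra.adjoin R
    ({x | ∃ h : 0 < n - 1, x = tau m n q v (Nat.lt_of_lt_pred h).pos} ∪
      {x | ∃ (i : ℕ) (h1 : 1 ≤ i) (h2 : i < n - 1),
        x = (sigma m n q v i h1 (Nat.lt_of_lt_pred h2) : H m n q v)})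

/-- The element `σ_j⁻¹ ⋯ σ_1⁻¹ τ^α σ_1 ⋯ σ_{n-1} b`. -/
def normalForm (hn : 0 < n) (j : Fin n) (α : ℕ) (b : H m n q v) : H m n q v :=
  sigmaInvDown m n q v j j.isLt * tau m n q v hn ^ α *
    sigmaUp m n q v (n - 1) (Nat.sub_lt hn Nat.one_pos) * b

end Elements

end CyclotomicHecke

set_option linter.unusedSimpArgs false

namespace CyclotomicHecke

/-! Spanning. The `R`-span of all elements `σ_j⁻¹ ⋯ σ_1⁻¹ τ^α σ_1 ⋯ σ_{n-1} b` with `b ∈ W̃`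
contains 1 (take `j = n - 1`, `α = 0`, `b = 1`), so it is everything once it is stable under left
multiplication by the generators. For `σ_i` this follows from the braid relations
(`sg_mul_mem_normalSpan`). For `τ` it rests on `tau_mul_conj`, which moves `τ` past `σ_1⁻¹ p(τ) σ_1`
for every polynomial `p`, with two correction terms that are multiples of `c = q - q⁻¹`.

Independence. These computations dictate how `H(m,1,n)` would have to act on the free-looking module
`⊕_{j<n} R[X]/(χ) ⊗ H(m,1,n-1)`, where `χ = (X - v_1) ⋯ (X - v_m)` and `p ⊗ a` at position `j`
stands for `σ_j⁻¹ ⋯ σ_1⁻¹ p(τ) σ_1 ⋯ σ_{n-1} a`. The operators `sOp` and `tOp` are defined by these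
formulas, and the defining relations are then checked for them (`IsInducing.isHecke`,
`IsInducing.aeval_tOp_eq_zero`), so the action exists. A normal form applied to `1 ⊗ 1` at the last
position yields `X^α ⊗ a` at position `j`, where `a` is a lift of `b` to `H(m,1,n-1)`. Mapping `a`
back to `b` separates the normal forms. Only lifts are used, so injectivity of `H(m,1,n-1) →
H(m,1,n)` is not needed. -/

/-- Elements `t` and `s 1, …, s (n - 1)` of an algebra that satisfy the relations of `H(m,1,n)`
except the cyclotomic one; the quadratic relation has the parameter `c` for `q - q⁻¹`. -/
structure IsHecke {R A : Type*} [CommRing R] [Ring A] [Algebra R A] (c : R) (n : ℕ) (t : A)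
    (s : ℕ → A) : Prop where
  braid : ∀ i, 1 ≤ i → i + 1 < n → s i * s (i + 1) * s i = s (i + 1) * s i * s (i + 1)
  far : ∀ i j, 1 ≤ i → i + 1 < j → j < n → Commute (s i) (s j)
  tau_sigma_one : 1 < n → t * s 1 * t * s 1 = s 1 * t * s 1 * t
  tau_far : ∀ i, 1 < i → i < n → Commute t (s i)
  quadratic : ∀ i, 1 ≤ i → i < n → s i * s i = c • s i + 1

/-- The monic polynomial `(X - v_1) ⋯ (X - v_m)`. -/
noncomputable def charPoly {R : Type*} [CommRing R] {m : ℕ} (v : Fin m → R) : Polynomial R :=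
  (List.ofFn fun k : Fin m => Polynomial.X - Polynomial.C (v k)).prod

/-! ### Consequences of the Hecke relations in an arbitrary algebra. -/

section Generic

variable {R A : Type*} [CommRing R] [Ring A] [Algebra R A]

theorem aeval_charPoly {m : ℕ} (v : Fin m → R) (t : A) :
    Polynomial.aeval t (charPoly v) =
      (List.ofFn fun k : Fin m => t - algebraMap R A (v k)).prod := by
  rw [charPoly, map_list_prod, List.map_ofFn]
  congr 2
  funext k
  simp

theorem charPoly_eq_prod {m : ℕ} (v : Fin m → R) :
    charPoly v = ∏ k, (Polynomial.X - Polynomial.C (v k)) := by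
  rw [charPoly, List.prod_ofFn]

theorem charPoly_monic {m : ℕ} (v : Fin m → R) : (charPoly v).Monic := by
  rw [charPoly_eq_prod]
  exact Polynomial.monic_prod_of_monic _ _ fun k _ => Polynomial.monic_X_sub_C _

theorem charPoly_natDegree [Nontrivial R] {m : ℕ} (v : Fin m → R) :
    (charPoly v).natDegree = m := by
  rw [charPoly_eq_prod,
    Polynomial.natDegree_prod_of_monic _ _ fun k _ => Polynomial.monic_X_sub_C _]
  simp

namespace IsHecke

variable {c : R} {n : ℕ} {t : A} {s : ℕ → A}

theorem map {B : Type*} [Ring B] [Algebra R B] (h : IsHecke c n t s) (f : A →ₐ[R] B) :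
    IsHecke c n (f t) (fun i => f (s i)) where
  braid i h1 h2 := by simpa only [map_mul] using congrArg f (h.braid i h1 h2)
  far i j h1 h2 h3 := (h.far i j h1 h2 h3).map f
  tau_sigma_one h1 := by simpa only [map_mul] using congrArg f (h.tau_sigma_one h1)
  tau_far i h1 h2 := (h.tau_far i h1 h2).map f
  quadratic i h1 h2 := by
    simpa only [map_mul, map_add, map_smul, map_one] using congrArg f (h.quadratic i h1 h2)

theorem mono {k : ℕ} (h : IsHecke c n t s) (hk : k ≤ n) : IsHecke c k t s where
  braid i h1 h2 := h.braid i h1 (h2.trans_le hk)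
  far i j h1 h2 h3 := h.far i j h1 h2 (h3.trans_le hk)
  tau_sigma_one h1 := h.tau_sigma_one (h1.trans_le hk)
  tau_far i h1 h2 := h.tau_far i h1 (h2.trans_le hk)
  quadratic i h1 h2 := h.quadratic i h1 (h2.trans_le hk)

theorem mul_inv (h : IsHecke c n t s) {i : ℕ} (h1 : 1 ≤ i) (h2 : i < n) :
    s i * (s i - c • 1) = 1 := by
  rw [mul_sub, h.quadratic i h1 h2, mul_smul_comm, mul_one, add_sub_cancel_left]

theorem inv_mul (h : IsHecke c n t s) {i : ℕ} (h1 : 1 ≤ i) (h2 : i < n) :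
    (s i - c • 1) * s i = 1 := by
  rw [sub_mul, h.quadratic i h1 h2, smul_mul_assoc, one_mul, add_sub_cancel_left]

/-- Commuting a polynomial in `t`, conjugated by `s 1`, past `t`. -/
theorem tau_mul_conj (h : IsHecke c n t s) (hn : 1 < n) (p : Polynomial R) :
    t * (s 1 - c • 1) * Polynomial.aeval t p * s 1 =
      (s 1 - c • 1) * Polynomial.aeval t p * s 1 * t +
        c • (t * s 1 * Polynomial.aeval t p) - c • (t * Polynomial.aeval t p * s 1) := by
  have hi := h.inv_mul le_rfl hn
  have hi' := h.mul_inv le_rfl hn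
  have hs := h.tau_sigma_one hn
  set a := s 1
  set b := a - c • (1 : A) with hb
  have hab : a = b + c • (1 : A) := by rw [hb, sub_add_cancel]
  induction p using Polynomial.induction_on' with
  | add p q hp hq =>
    simp only [map_add, mul_add, add_mul, smul_add] at hp hq ⊢
    rw [hp, hq]; abel
  | monomial k r =>
    rw [← Polynomial.smul_X_eq_monomial, map_smul, map_pow, Polynomial.aeval_X]
    simp only [mul_smul_comm, smul_mul_assoc]
    rw [smul_comm c r, smul_comm c r, ← smul_add, ← smul_sub]
    congr 1
    clear r
    -- the two forms of the type B braid relation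
    have h1 : b * t * a * t * a = t * a * t := by
      calc b * t * a * t * a = b * (t * a * t * a) := by noncomm_ring
        _ = (b * a) * (t * a * t) := by rw [hs]; noncomm_ring
        _ = t * a * t := by rw [hi, one_mul]
    -- This is the claim for `p = X`; the induction below multiplies it by `b * t ^ k * a`.
    have h2 : t * b * t * a = b * t * a * t + c • (t * a * t) - c • (t * t * a) := by
      have e : t * a * t * a = a * t * a * t := hs
      have e1 : t * b * t * a = t * a * t * a - c • (t * t * a) := by
        rw [hb]; simp only [mul_sub, sub_mul, mul_smul_comm, smul_mul_assoc, mul_one]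
      have e2 : a * t * a * t = b * t * a * t + c • (t * a * t) := by
        rw [hb]; simp only [sub_mul, smul_mul_assoc, one_mul, sub_add_cancel]
      rw [e1, e, e2]
    induction k with
    | zero => simp [mul_assoc, hi]
    | succ k ih =>
      -- Inserting `a * b = 1` splits one conjugated factor `b * t * a` off the conjugated power.
      have e0 : t * b * t ^ (k + 1) * a = t * b * t * a * (b * t ^ k * a) := by
        calc t * b * t ^ (k + 1) * a = t * b * t * 1 * (t ^ k * a) := by
              rw [pow_succ']; noncomm_ring
          _ = _ := by rw [← hi']; noncomm_ring
      have e1 : b * t ^ (k + 1) * a = b * t * a * (b * t ^ k * a) := by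
        calc b * t ^ (k + 1) * a = b * t * 1 * (t ^ k * a) := by rw [pow_succ']; noncomm_ring
          _ = _ := by rw [← hi']; noncomm_ring
      have e2 : t * a * t * (b * t ^ k * a) = b * t * a * t * t ^ k * a := by
        calc t * a * t * (b * t ^ k * a) = b * t * a * t * (a * b) * (t ^ k * a) := by
              rw [← h1]; noncomm_ring
          _ = _ := by rw [hi']; noncomm_ring
      have e3 : t * t * a * (b * t ^ k * a) = t * t ^ (k + 1) * a := by
        calc t * t * a * (b * t ^ k * a) = t * t * (a * b) * (t ^ k * a) := by noncomm_ring
          _ = _ := by rw [hi', pow_succ']; noncomm_ring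
      have e4 : b * t * a * t * (a * t ^ k) = t * a * t ^ (k + 1) := by
        calc b * t * a * t * (a * t ^ k) = b * t * a * t * a * t ^ k := by noncomm_ring
          _ = _ := by rw [h1, pow_succ']; noncomm_ring
      have e5 : b * t * a * (t * b * t ^ k * a) = b * t * a * (b * t ^ k * a * t) +
          c • (t * a * t ^ (k + 1)) - c • (b * t * a * t * t ^ k * a) := by
        rw [ih, mul_sub, mul_add, mul_smul_comm, mul_smul_comm, ← e4]
        noncomm_ring
      rw [e0, h2, sub_mul, add_mul, smul_mul_assoc, smul_mul_assoc, e2, e3]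
      have e6 : b * t * a * t * (b * t ^ k * a) = b * t * a * (t * b * t ^ k * a) := by
        noncomm_ring
      rw [e6, e5, e1]
      have e7 : b * t * a * (b * t ^ k * a * t) = b * t * a * (b * t ^ k * a) * t := by
        noncomm_ring
      rw [e7]
      abel

end IsHecke

end Generic

/-! ### Universal property and generators of `H(m,1,n)`. -/

section Lift

variable {R : Type*} [CommRing R] {m n : ℕ} {q : Rˣ} {v : Fin m → R}

variable (m n q v) in
/-- The generator `σ_i`, with the value `0` for indices out of range. -/
noncomputable def sg (i : ℕ) : H m n q v :=
  if h : 1 ≤ i ∧ i < n then sigmaElt m n q v i h.1 h.2 else 0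

variable (m n q v) in
/-- The generator `τ`, with the value `0` for `n = 0`. -/
noncomputable def tg : H m n q v := if h : 0 < n then tau m n q v h else 0

theorem sg_eq {i : ℕ} (h1 : 1 ≤ i) (h2 : i < n) : sg m n q v i = sigmaElt m n q v i h1 h2 :=
  dif_pos ⟨h1, h2⟩

theorem tg_eq (h : 0 < n) : tg m n q v = tau m n q v h := dif_pos h

variable (m n q v) in
theorem isHecke_H :
    IsHecke ((q : R) - ((q⁻¹ : Rˣ) : R)) n (tg m n q v) (sg m n q v) where
  braid i h1 h2 := by
    rw [sg_eq h1 (by lia), sg_eq (by lia) h2]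
    have := RingQuot.mkAlgHom_rel R (Rel.braid (m := m) (q := q) (v := v) i h1 h2)
    simp only [map_mul] at this
    exact this
  far i j h1 h2 h3 := by
    rw [sg_eq h1 (by lia), sg_eq (by lia) h3]
    have := RingQuot.mkAlgHom_rel R (Rel.far (m := m) (q := q) (v := v) i j h1 (by lia) (by lia) h3
      (by rw [lt_abs]; right; lia))
    simp only [map_mul] at this
    exact this
  tau_sigma_one h1 := by
    rw [sg_eq le_rfl h1, tg_eq (by lia)]
    have := RingQuot.mkAlgHom_rel R (Rel.tau_sigma_one (m := m) (q := q) (v := v) (by lia) h1)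
    simp only [map_mul] at this
    exact this
  tau_far i h1 h2 := by
    rw [sg_eq h1.le h2, tg_eq (by lia)]
    have := RingQuot.mkAlgHom_rel R (Rel.tau_far (m := m) (q := q) (v := v) (by lia) i h1.le h2 h1)
    simp only [map_mul] at this
    exact this
  quadratic i h1 h2 := by rw [sg_eq h1 h2]; exact sigmaElt_mul_self m n q v i h1 h2

theorem aeval_tg_charPoly (h : 0 < n) : Polynomial.aeval (tg m n q v) (charPoly v) = 0 := by
  rw [aeval_charPoly, tg_eq h, cyclotomic_tau]

variable {A : Type*} [Ring A] [Algebra R A] {t : A} {s : ℕ → A}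

/-- The values of a homomorphism from `H(m,1,n)` on the generators. -/
def genMap (t : A) (s : ℕ → A) : Gen n → A
  | .tau _ => t
  | .sigma i _ _ => s i

/-- The universal property of `H(m,1,n)`. -/
noncomputable def liftH (h : IsHecke ((q : R) - ((q⁻¹ : Rˣ) : R)) n t s)
    (ht : 0 < n → Polynomial.aeval t (charPoly v) = 0) : H m n q v →ₐ[R] A :=
  RingQuot.liftAlgHom R ⟨FreeAlgebra.lift R (genMap t s), by
    intro x y hxy
    cases hxy with
    | braid i h1 h2 => simpa [genMap] using h.braid i h1 h2
    | far i j hi1 hi2 hj1 hj2 hij =>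
      simp only [map_mul, FreeAlgebra.lift_ι_apply, genMap]
      rcases lt_or_ge i j with hlt | hge
      · exact h.far i j hi1 (by rw [lt_abs] at hij; lia) hj2
      · exact (h.far j i hj1 (by rw [lt_abs] at hij; lia) hi2).symm
    | tau_sigma_one h0 h1 => simpa [genMap] using h.tau_sigma_one h1
    | tau_far h0 i h1 h2 hi => simpa [genMap] using (h.tau_far i hi h2).eq
    | quadratic i h1 h2 =>
      simpa only [pow_two, map_mul, map_add, map_smul, map_one, FreeAlgebra.lift_ι_apply, genMap]
        using h.quadratic i h1 h2
    | cyclotomic h0 =>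
      rw [map_zero, ← ht h0, aeval_charPoly, map_list_prod, List.map_ofFn]
      congr 2
      funext k
      simp [genMap]⟩

theorem liftH_tg (h : IsHecke ((q : R) - ((q⁻¹ : Rˣ) : R)) n t s)
    (ht : 0 < n → Polynomial.aeval t (charPoly v) = 0) (hn : 0 < n) :
    liftH h ht (tg m n q v) = t := by
  rw [tg_eq hn, liftH, tau, RingQuot.liftAlgHom_mkAlgHom_apply, FreeAlgebra.lift_ι_apply]; rfl

theorem liftH_sg (h : IsHecke ((q : R) - ((q⁻¹ : Rˣ) : R)) n t s)
    (ht : 0 < n → Polynomial.aeval t (charPoly v) = 0) {i : ℕ} (h1 : 1 ≤ i) (h2 : i < n) :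
    liftH h ht (sg m n q v i) = s i := by
  rw [sg_eq h1 h2, liftH, sigmaElt, RingQuot.liftAlgHom_mkAlgHom_apply,
    FreeAlgebra.lift_ι_apply]; rfl

variable (m n q v) in
/-- `H(m,1,n)` is generated by `τ` and the `σ_i`. -/
theorem adjoin_eq_top : Algebra.adjoin R
    ({x | 0 < n ∧ x = tg m n q v} ∪ {x | ∃ i, 1 ≤ i ∧ i < n ∧ x = sg m n q v i}) = ⊤ := by
  rw [eq_top_iff]
  rintro x -
  obtain ⟨y, rfl⟩ := RingQuot.mkAlgHom_surjective R (Rel m n q v) x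
  induction y using FreeAlgebra.induction with
  | grade0 r => rw [AlgHom.commutes]; exact Subalgebra.algebraMap_mem _ r
  | grade1 g =>
    apply Algebra.subset_adjoin
    cases g with
    | tau h => exact Or.inl ⟨h, (tg_eq h).symm⟩
    | sigma i h1 h2 => exact Or.inr ⟨i, h1, h2, (sg_eq h1 h2).symm⟩
  | mul a b ha hb => rw [map_mul]; exact mul_mem ha hb
  | add a b ha hb => rw [map_add]; exact add_mem ha hb

end Lift

/-! ### The words `s_k⁻¹ ⋯ s_1⁻¹` and `s_1 ⋯ s_k`. -/

section Words

variable {R A : Type*} [CommRing R] [Ring A] [Algebra R A]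

/-- The product `s_k⁻¹ ⋯ s_1⁻¹`, where `s_i⁻¹` is written as `s_i - c`. -/
def downWord (c : R) (s : ℕ → A) : ℕ → A
  | 0 => 1
  | k + 1 => (s (k + 1) - c • 1) * downWord c s k

/-- The product `s_1 ⋯ s_k`. -/
def upWord (s : ℕ → A) : ℕ → A
  | 0 => 1
  | k + 1 => upWord s k * s (k + 1)

theorem commute_inv {c : R} {x y : A} (h : Commute x y) : Commute x (y - c • 1) :=
  h.sub_right ((Commute.one_right x).smul_right c)

theorem commute_downWord {c : R} {s : ℕ → A} {x : A} {k : ℕ}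
    (h : ∀ i, 1 ≤ i → i ≤ k → Commute x (s i)) : Commute x (downWord c s k) := by
  induction k with
  | zero => exact Commute.one_right x
  | succ k ih =>
    exact (commute_inv (h _ (by lia) le_rfl)).mul_right (ih fun i h1 h2 => h i h1 (by lia))

/-- The letter `s_1⁻¹` split off from `s_k⁻¹ ⋯ s_1⁻¹`. -/
theorem exists_downWord_eq (c : R) (s : ℕ → A) (k : ℕ) :
    ∃ w, downWord c s (k + 1) = w * (s 1 - c • 1) ∧
      ∀ x, (∀ i, 1 < i → i ≤ k + 1 → Commute x (s i)) → Commute x w := by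
  induction k with
  | zero => exact ⟨1, by simp [downWord], fun x _ => Commute.one_right x⟩
  | succ k ih =>
    obtain ⟨w, h1, h2⟩ := ih
    refine ⟨(s (k + 2) - c • 1) * w, by rw [downWord, h1, mul_assoc], fun x hx => ?_⟩
    exact (commute_inv (hx _ (by lia) le_rfl)).mul_right (h2 x fun i h3 h4 => hx i h3 (by lia))

/-- The letter `s_1` split off from `s_1 ⋯ s_k`. -/
theorem exists_upWord_eq (s : ℕ → A) (k : ℕ) :
    ∃ w, upWord s (k + 1) = s 1 * w ∧
      ∀ x, (∀ i, 1 < i → i ≤ k + 1 → Commute x (s i)) → Commute x w := by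
  induction k with
  | zero => exact ⟨1, by simp [upWord], fun x _ => Commute.one_right x⟩
  | succ k ih =>
    obtain ⟨w, h1, h2⟩ := ih
    refine ⟨w * s (k + 2), by rw [upWord, h1, mul_assoc], fun x hx => ?_⟩
    exact (h2 x fun i h3 h4 => hx i h3 (by lia)).mul_right (hx _ (by lia) le_rfl)

namespace IsHecke

variable {c : R} {n : ℕ} {t : A} {s : ℕ → A}

theorem downWord_mul_upWord (h : IsHecke c n t s) {k : ℕ} (hk : k < n) :
    downWord c s k * upWord s k = 1 := by
  induction k with
  | zero => exact one_mul 1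
  | succ k ih =>
    rw [downWord, upWord, mul_assoc, ← mul_assoc (downWord c s k), ih (by lia), one_mul,
      h.inv_mul (by lia) hk]

theorem far_downWord (h : IsHecke c n t s) {i k : ℕ} (hk : k + 1 < i) (hi : i < n) :
    Commute (s i) (downWord c s k) :=
  commute_downWord fun j h1 h2 => (h.far j i h1 (by lia) hi).symm

/-- The letter passes the far ones, and the braid relation at `s_{i+1}⁻¹ s_i⁻¹` raises its index. In
`mul_upWord` the index drops again, so a normal form with `i < j` lets `σ_i` through unchanged. -/
theorem mul_downWord (h : IsHecke c n t s) {i k : ℕ} (h1 : 1 ≤ i) (hik : i < k) (hk : k < n) :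
    s i * downWord c s k = downWord c s k * s (i + 1) := by
  induction k with
  | zero => lia
  | succ k ih =>
    rcases Nat.lt_succ_iff_lt_or_eq.1 hik with hlt | rfl
    · rw [downWord, ← mul_assoc, (commute_inv (h.far i (k + 1) h1 (by lia) hk)).eq, mul_assoc,
        ih hlt (by lia), mul_assoc]
    · obtain ⟨i, rfl⟩ := Nat.exists_eq_add_of_le' h1
      -- The braid relation with two letters inverted, checked by expanding the inverses.
      have e : s (i + 1) * (s (i + 2) - c • 1) * (s (i + 1) - c • 1) =
          (s (i + 2) - c • 1) * (s (i + 1) - c • 1) * s (i + 2) := by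
        have e1 := h.braid (i + 1) h1 hk
        have e2 := h.quadratic (i + 1) h1 (by lia)
        have e3 := h.quadratic (i + 2) (by lia) hk
        simp only [mul_sub, sub_mul, mul_smul_comm, smul_mul_assoc, mul_one, one_mul, e1, e2, e3,
          smul_add, smul_sub]
        abel
      calc s (i + 1) * downWord c s (i + 2)
          = (s (i + 1) * (s (i + 2) - c • 1) * (s (i + 1) - c • 1)) * downWord c s i := by
            simp only [downWord, mul_assoc]
        _ = (s (i + 2) - c • 1) * (s (i + 1) - c • 1) * (s (i + 2) * downWord c s i) := by
            rw [e]; simp only [mul_assoc]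
        _ = _ := by
            rw [(h.far_downWord (by lia) hk).eq]; simp only [downWord, mul_assoc]

theorem far_upWord (h : IsHecke c n t s) {i k : ℕ} (hk : k + 1 < i) (hi : i < n) :
    Commute (s i) (upWord s k) := by
  induction k with
  | zero => exact Commute.one_right _
  | succ k ih => exact (ih (by lia)).mul_right (h.far (k + 1) i (by lia) (by lia) hi).symm

theorem mul_upWord (h : IsHecke c n t s) {i k : ℕ} (h1 : 1 ≤ i) (hik : i < k) (hk : k < n) :
    s (i + 1) * upWord s k = upWord s k * s i := by
  induction k with
  | zero => lia
  | succ k ih =>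
    rcases Nat.lt_succ_iff_lt_or_eq.1 hik with hlt | rfl
    · rw [upWord, ← mul_assoc, ih hlt (by lia), mul_assoc, (h.far i (k + 1) h1 (by lia) hk).eq,
        mul_assoc]
    · obtain ⟨i, rfl⟩ := Nat.exists_eq_add_of_le' h1
      calc s (i + 2) * upWord s (i + 2)
          = s (i + 2) * upWord s i * s (i + 1) * s (i + 2) := by simp only [upWord, mul_assoc]
        _ = upWord s i * (s (i + 2) * s (i + 1) * s (i + 2)) := by
            rw [(h.far_upWord (by lia) hk).eq]; simp only [mul_assoc]
        _ = _ := by rw [← h.braid (i + 1) h1 hk]; simp only [upWord, mul_assoc]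

end IsHecke

end Words

/-! ### The induced module and the relations among the `σ_i` on it. -/

section Induced

variable {R N : Type*} [CommRing R] [AddCommGroup N] [Module R N]

variable (R N) in
/-- The embedding of `N` at position `j`, with the value `0` for positions out of range. -/
noncomputable def vec (n j : ℕ) : N →ₗ[R] (Fin n →₀ N) :=
  if h : j < n then Finsupp.lsingle ⟨j, h⟩ else 0

/-- The action of `σ_i` on the induced module. -/
noncomputable def sOp (n : ℕ) (c : R) (s : ℕ → Module.End R N) (i : ℕ) :
    Module.End R (Fin n →₀ N) :=
  Finsupp.lsum R fun j : Fin n =>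
    -- With `p ⊗ a` at position `j` read as `σ_j⁻¹ ⋯ σ_1⁻¹ p(τ) σ_1 ⋯ σ_{n-1} a`, the cases are:
    -- `σ_i` passes the whole word and emerges as `σ_{i-1}`; `σ_{j+1} = σ_{j+1}⁻¹ + c` lengthens the
    -- word; `σ_j` cancels its first letter; `σ_i` passes both words and emerges as `σ_i`.
    if (j : ℕ) + 1 < i then vec R N n j ∘ₗ s (i - 1)
    else if i = j + 1 then vec R N n i + c • vec R N n j
    else if (j : ℕ) = i then vec R N n (i - 1)
    else vec R N n j ∘ₗ s i

/-- The action of `τ` on the induced module. -/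
noncomputable def tOp (n : ℕ) (c : R) (t X E : Module.End R N) (s : ℕ → Module.End R N) :
    Module.End R (Fin n →₀ N) :=
  Finsupp.lsum R fun j : Fin n =>
    if (j : ℕ) = 0 then vec R N n 0 ∘ₗ X
    -- The correction terms of `tau_mul_conj` begin with `σ_j⁻¹ ⋯ σ_2⁻¹`. This word commutes with
    -- `τ` and passes through `σ_1 ⋯ σ_{n-1}` as `σ_{j-1}⁻¹ ⋯ σ_1⁻¹`, which puts both terms at
    -- position 0: `E` accounts for the term with `p(τ)` moved to the right, `-1` for the other.
    else vec R N n j ∘ₗ t + c • (vec R N n 0 ∘ₗ (X * downWord c s (j - 1) * (E - 1)))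

theorem lsum_vec {n j : ℕ} (hj : j < n) (F : Fin n → N →ₗ[R] (Fin n →₀ N)) (f : N) :
    Finsupp.lsum R F (vec R N n j f) = F ⟨j, hj⟩ f := by
  rw [vec, dif_pos hj, Finsupp.lsingle_apply, Finsupp.lsum_single]

theorem ext_vec {n : ℕ} {F G : Module.End R (Fin n →₀ N)}
    (h : ∀ j, j < n → ∀ f, F (vec R N n j f) = G (vec R N n j f)) : F = G := by
  refine Finsupp.lhom_ext fun j f => ?_
  have := h j j.isLt f
  rwa [vec, dif_pos j.isLt] at this

section Formulas

variable {n : ℕ} {c : R} {t X E : Module.End R N} {s : ℕ → Module.End R N}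

theorem sOp_lt {i j : ℕ} (f : N) (hij : j + 1 < i) (hi : i < n) :
    sOp n c s i (vec R N n j f) = vec R N n j (s (i - 1) f) := by
  rw [sOp, lsum_vec (by lia), if_pos hij]; rfl

theorem sOp_up {i j : ℕ} (f : N) (hij : i = j + 1) (hi : i < n) :
    sOp n c s i (vec R N n j f) = vec R N n i f + c • vec R N n j f := by
  rw [sOp, lsum_vec (by lia), if_neg (by simp only; lia), if_pos hij]; rfl

theorem sOp_down {i j : ℕ} (f : N) (hij : j = i) (hi : i < n) :
    sOp n c s i (vec R N n j f) = vec R N n (i - 1) f := by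
  rw [sOp, lsum_vec (by lia), if_neg (by simp only; lia), if_neg (by simp only; lia), if_pos hij]

theorem sOp_gt {i j : ℕ} (f : N) (hij : i < j) (hj : j < n) :
    sOp n c s i (vec R N n j f) = vec R N n j (s i f) := by
  rw [sOp, lsum_vec (by lia), if_neg (by simp only; lia), if_neg (by simp only; lia),
    if_neg (by simp only; lia)]; rfl

theorem tOp_zero {j : ℕ} (f : N) (hj : j = 0) (hn : 0 < n) :
    tOp n c t X E s (vec R N n j f) = vec R N n 0 (X f) := by
  rw [tOp, lsum_vec (by lia), if_pos hj]; rfl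

theorem tOp_pos {j : ℕ} (f : N) (hj : 0 < j) (hn : j < n) :
    tOp n c t X E s (vec R N n j f) =
      vec R N n j (t f) + c • vec R N n 0 (X (downWord c s (j - 1) (E f - f))) := by
  rw [tOp, lsum_vec (by lia), if_neg (by simp only; lia)]; rfl

end Formulas

/-- Operators on `N = R[X]/(χ) ⊗ H(m,1,n-1)`: left multiplications by `X`, `τ` and `σ_i`, and the
operator `E` that sends `p ⊗ a` to `1 ⊗ p(τ) a`. -/
structure IsInducing (n : ℕ) (c : R) (t X E : Module.End R N) (s : ℕ → Module.End R N) : Prop where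
  hecke : IsHecke c (n - 1) t s
  X_t : Commute X t
  X_s : ∀ i, 1 ≤ i → i + 1 < n → Commute X (s i)
  E_X : E * X = t * E
  E_t : Commute E t
  E_s : ∀ i, 1 < i → i + 1 < n → Commute E (s i)
  E_E : E * E = E
  E_s_E : ∀ i, 1 ≤ i → i + 1 < n → E * s i * E = s i * E
  -- This is `tau_mul_conj` for all polynomials at once, with `E` in the role of evaluation at `t`.
  conj : 2 < n → t * (s 1 - c • 1) * E * s 1 =
    (s 1 - c • 1) * E * s 1 * t + c • (t * s 1 * E) - c • (t * E * s 1)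
  -- Divisibility of `p(t) - p(X)` by `t - X`, needed for the cyclotomic relation.
  div : 1 < n → ∀ f, ∃ g, E f - f = t g - X g

namespace IsInducing

variable {n : ℕ} {c : R} {t X E : Module.End R N} {s : ℕ → Module.End R N}

theorem quadratic_op (h : IsInducing n c t X E s) {i : ℕ} (h1 : 1 ≤ i) (h2 : i < n) :
    sOp n c s i * sOp n c s i = c • sOp n c s i + 1 := by
  obtain ⟨i, rfl⟩ := Nat.exists_eq_add_of_le' h1
  refine ext_vec fun j hj f => ?_
  simp only [Module.End.mul_apply, LinearMap.add_apply, LinearMap.smul_apply, Module.End.one_apply]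
  rcases lt_trichotomy j i with hlt | rfl | hgt
  · have e := LinearMap.congr_fun (h.hecke.quadratic i (by lia) (by lia)) f
    simp only [Module.End.mul_apply, LinearMap.add_apply, LinearMap.smul_apply,
      Module.End.one_apply] at e
    simp (disch := lia) only [sOp_lt, Nat.add_sub_cancel, e, map_add, map_smul]
  · simp (disch := lia) only [sOp_up, sOp_down, Nat.add_sub_cancel, map_add, map_smul]
    abel
  · rcases Nat.lt_or_eq_of_le hgt with hgt | rfl
    · have e := LinearMap.congr_fun (h.hecke.quadratic (i + 1) (by lia) (by lia)) f
      simp only [Module.End.mul_apply, LinearMap.add_apply, LinearMap.smul_apply,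
        Module.End.one_apply] at e
      simp (disch := lia) only [sOp_gt, e, map_add, map_smul]
    · simp (disch := lia) only [sOp_up, sOp_down, Nat.add_sub_cancel, Nat.succ_eq_add_one]
      abel

/-- The two operators mix only the positions `i - 1`, `i`, `i + 1`. Elsewhere the claim is a braid
relation of the smaller algebra, with indices lowered by one at positions below `i - 1`. -/
theorem braid_op (h : IsInducing n c t X E s) {i : ℕ} (h1 : 1 ≤ i) (h2 : i + 1 < n) :
    sOp n c s i * sOp n c s (i + 1) * sOp n c s i =
      sOp n c s (i + 1) * sOp n c s i * sOp n c s (i + 1) := by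
  obtain ⟨i, rfl⟩ := Nat.exists_eq_add_of_le' h1
  refine ext_vec fun j hj f => ?_
  simp only [Module.End.mul_apply]
  obtain hlt | rfl | rfl | rfl | hgt :
      j < i ∨ j = i ∨ j = i + 1 ∨ j = i + 2 ∨ i + 2 < j := by lia
  · have e := LinearMap.congr_fun (h.hecke.braid i (by lia) (by lia)) f
    simp only [Module.End.mul_apply] at e
    simp (disch := lia) only [sOp_lt, Nat.add_sub_cancel, e]
  -- Here `σ_{j+2}` acts twice at position `j` through `s (j + 1)`, and its square has to be
  -- reduced.
  · have q := LinearMap.congr_fun (h.hecke.quadratic (j + 1) (by lia) (by lia)) f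
    simp only [Module.End.mul_apply, LinearMap.add_apply, LinearMap.smul_apply,
      Module.End.one_apply] at q
    simp (disch := lia) only [sOp_lt, sOp_gt, sOp_up, sOp_down, Nat.add_sub_cancel, map_add,
      map_smul, q, smul_add]
    abel
  · simp (disch := lia) only [sOp_lt, sOp_gt, sOp_up, sOp_down, Nat.add_sub_cancel, map_add,
      map_smul]
    try abel
  · simp (disch := lia) only [sOp_lt, sOp_gt, sOp_up, sOp_down, Nat.add_sub_cancel, map_add,
      map_smul]
    try abel
  · have e := LinearMap.congr_fun (h.hecke.braid (i + 1) (by lia) (by lia)) f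
    simp only [Module.End.mul_apply] at e
    simp (disch := lia) only [sOp_gt, e]

theorem far_op (h : IsInducing n c t X E s) {i k : ℕ} (h1 : 1 ≤ i) (h2 : i + 1 < k) (h3 : k < n) :
    Commute (sOp n c s i) (sOp n c s k) := by
  obtain ⟨i, rfl⟩ := Nat.exists_eq_add_of_le' h1
  obtain ⟨k, rfl⟩ := Nat.exists_eq_add_of_le' (show 1 ≤ k by lia)
  refine ext_vec fun j hj f => ?_
  simp only [Module.End.mul_apply]
  obtain hlt | rfl | rfl | hm | rfl | rfl | hgt :
      j < i ∨ j = i ∨ j = i + 1 ∨ (i + 1 < j ∧ j < k) ∨ j = k ∨ j = k + 1 ∨ k + 1 < j := by lia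
  · have e := LinearMap.congr_fun (h.hecke.far i k (by lia) (by lia) (by lia)).eq f
    simp only [Module.End.mul_apply] at e
    simp (disch := lia) only [sOp_lt, Nat.add_sub_cancel, e]
  · simp (disch := lia) only [sOp_lt, sOp_gt, sOp_up, sOp_down, Nat.add_sub_cancel, map_add,
      map_smul]
  · simp (disch := lia) only [sOp_lt, sOp_gt, sOp_up, sOp_down, Nat.add_sub_cancel, map_add,
      map_smul]
  · have e := LinearMap.congr_fun (h.hecke.far (i + 1) k (by lia) (by lia) (by lia)).eq f
    simp only [Module.End.mul_apply] at e
    simp (disch := lia) only [sOp_lt, sOp_gt, Nat.add_sub_cancel, e]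
  · simp (disch := lia) only [sOp_lt, sOp_gt, sOp_up, sOp_down, Nat.add_sub_cancel, map_add,
      map_smul]
  · simp (disch := lia) only [sOp_lt, sOp_gt, sOp_up, sOp_down, Nat.add_sub_cancel, map_add,
      map_smul]
  · have e := LinearMap.congr_fun (h.hecke.far (i + 1) (k + 1) (by lia) (by lia) (by lia)).eq f
    simp only [Module.End.mul_apply] at e
    simp (disch := lia) only [sOp_gt, e]

end IsInducing

end Induced

/-! ### The relations involving `τ` on the induced module. -/

section Induced

variable {R N : Type*} [CommRing R] [AddCommGroup N] [Module R N]

namespace IsInducing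

variable {n : ℕ} {c : R} {t X E : Module.End R N} {s : ℕ → Module.End R N}

theorem X_downWord (h : IsInducing n c t X E s) {k : ℕ} (hk : k + 1 < n) :
    Commute X (downWord c s k) :=
  commute_downWord fun i h1 h2 => h.X_s i h1 (by lia)

/-- The idempotent `E` fixes its image pointwise, and by `E_s_E` that image is stable under the `s
i` used here, hence under their inverses. -/
theorem E_downWord_E (h : IsInducing n c t X E s) {k : ℕ} (hk : k + 1 < n) :
    E * downWord c s k * E = downWord c s k * E := by
  induction k with
  | zero => simpa [downWord] using h.E_E
  | succ k ih =>
    have e1 := ih (by lia)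
    have e2 := h.E_s_E (k + 1) (by lia) (by lia)
    have e3 : E * (s (k + 1) - c • 1) * E = (s (k + 1) - c • 1) * E := by
      simp only [mul_sub, sub_mul, e2, mul_smul_comm, smul_mul_assoc, mul_one, one_mul, h.E_E]
    calc E * downWord c s (k + 1) * E
        = E * (s (k + 1) - c • 1) * (downWord c s k * E) := by simp only [downWord, mul_assoc]
      _ = E * (s (k + 1) - c • 1) * E * (downWord c s k * E) := by
        rw [← e1]
        simp only [mul_assoc]
        rw [← mul_assoc E E, h.E_E]
      _ = _ := by rw [e3, mul_assoc, ← mul_assoc E, e1, downWord, mul_assoc]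

/-- The off-diagonal entry of `τ` satisfies the relation needed for `τ σ_1 τ σ_1 = σ_1 τ σ_1 τ`. -/
theorem offDiagonal (h : IsInducing n c t X E s) {k : ℕ} (hk : k + 2 < n) :
    X * downWord c s (k + 1) * (E - 1) * s 1 * t +
      c • (X * E * (X * downWord c s (k + 1) * (E - 1))) =
    t * (X * downWord c s (k + 1) * (E - 1)) * s 1 := by
  obtain ⟨w, hw, hc⟩ := exists_downWord_eq c s k
  have hwt : t * w = w * t := hc t fun i h1 h2 => h.hecke.tau_far i h1 (by lia)
  have hwE : E * w = w * E := hc E fun i h1 h2 => h.E_s i h1 (by lia)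
  have hED := h.E_downWord_E (k := k + 1) (by lia)
  have hi := h.hecke.inv_mul le_rfl (show 1 < n - 1 by lia)
  have hXt : X * t = t * X := h.X_t
  rw [hw] at hED ⊢
  set b := s 1 - c • 1 with hb
  -- Since `w` commutes with `t`, `E` and `X * t = t * X`, every term acquires the common left
  -- factor `X * w`; what remains is exactly `conj`.
  have e1 : E * (X * (w * b) * (E - 1)) = w * (t * b * E - t * E * b) := by
    calc E * (X * (w * b) * (E - 1)) = (E * X) * (w * b) * E - E * X * (w * b) := by noncomm_ring
      _ = t * (E * (w * b) * E) - t * (E * w) * b := by rw [h.E_X]; noncomm_ring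
      _ = (t * w) * b * E - (t * w) * E * b := by rw [hED, hwE]; noncomm_ring
      _ = _ := by rw [hwt]; noncomm_ring
  have e2 : X * (w * b) * (E - 1) * s 1 * t = X * w * (b * E * s 1 * t - t) := by
    calc X * (w * b) * (E - 1) * s 1 * t
        = X * w * (b * E * s 1 * t) - X * w * (b * s 1) * t := by noncomm_ring
      _ = _ := by rw [hi]; noncomm_ring
  have e3 : t * (X * (w * b) * (E - 1)) * s 1 = X * w * (t * b * E * s 1 - t) := by
    calc t * (X * (w * b) * (E - 1)) * s 1
        = (t * X) * w * (b * E * s 1 - b * s 1) := by noncomm_ring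
      _ = X * (t * w) * (b * E * s 1 - b * s 1) := by rw [← hXt]; noncomm_ring
      _ = _ := by rw [hi, hwt]; noncomm_ring
  have e4 : c • (t * b * E - t * E * b) = c • (t * s 1 * E) - c • (t * E * s 1) := by
    rw [hb, ← smul_sub]
    congr 1
    simp only [mul_sub, sub_mul, mul_smul_comm, smul_mul_assoc, mul_one]
    abel
  rw [mul_assoc X E, e1, e2, e3, h.conj (by lia), ← mul_assoc, ← mul_smul_comm, ← mul_add, e4]
  congr 1
  abel

theorem tau_far_op (h : IsInducing n c t X E s) {i : ℕ} (h1 : 1 < i) (h2 : i < n) :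
    Commute (tOp n c t X E s) (sOp n c s i) := by
  obtain ⟨i, rfl⟩ := Nat.exists_eq_add_of_le' h1
  refine ext_vec fun j hj f => ?_
  simp only [Module.End.mul_apply]
  have hX := LinearMap.congr_fun (h.X_s (i + 1) (by lia) (by lia)).eq
  simp only [Module.End.mul_apply] at hX
  obtain rfl | ⟨h0, hlt⟩ | rfl | rfl | hgt :
      j = 0 ∨ (0 < j ∧ j < i + 1) ∨ j = i + 1 ∨ j = i + 2 ∨ i + 2 < j := by lia
  · simp (disch := lia) only [sOp_lt, tOp_zero, Nat.add_sub_cancel, Nat.add_succ_sub_one, hX]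
  · have et := LinearMap.congr_fun (h.hecke.tau_far (i + 1) (by lia) (by lia)).eq f
    have eE := LinearMap.congr_fun (h.E_s (i + 1) (by lia) (by lia)).eq f
    have eD := LinearMap.congr_fun
      (h.hecke.far_downWord (i := i + 1) (k := j - 1) (by lia) (by lia)).eq
    simp only [Module.End.mul_apply] at et eE eD
    simp (disch := lia) only [sOp_lt, tOp_pos, Nat.add_sub_cancel, Nat.add_succ_sub_one, map_add,
      map_smul, et, eE, ← map_sub, ← hX, eD]
  · simp (disch := lia) only [sOp_lt, sOp_up, tOp_pos, Nat.add_sub_cancel, Nat.add_succ_sub_one,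
      map_add, map_smul, downWord, Module.End.mul_apply, LinearMap.sub_apply, LinearMap.smul_apply,
      Module.End.one_apply, ← hX]
    simp only [map_sub, map_smul]
    module
  · have e := LinearMap.congr_fun (h.hecke.mul_inv (i := i + 1) (by lia) (by lia))
    simp only [Module.End.mul_apply, Module.End.one_apply] at e
    simp (disch := lia) only [sOp_lt, sOp_down, tOp_pos, Nat.add_sub_cancel, Nat.add_succ_sub_one,
      map_add, map_smul, downWord, Module.End.mul_apply, ← hX, e]
  · have et := LinearMap.congr_fun (h.hecke.tau_far (i + 2) (by lia) (by lia)).eq f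
    have eE := LinearMap.congr_fun (h.E_s (i + 2) (by lia) (by lia)).eq f
    -- `σ_{i+2}` acts as `s (i + 2)` at position `j` but as `s (i + 1)` at position 0; the word in
    -- the off-diagonal entry intertwines the two.
    have eD := LinearMap.congr_fun
      (h.hecke.mul_downWord (i := i + 1) (k := j - 1) (by lia) (by lia) (by lia))
    simp only [Module.End.mul_apply] at et eE eD
    simp (disch := lia) only [sOp_lt, sOp_gt, tOp_pos, Nat.add_sub_cancel, Nat.add_succ_sub_one,
      map_add, map_smul, et, eE, ← map_sub, ← hX, eD]

theorem tau_sigma_one_op (h : IsInducing n c t X E s) (hn : 1 < n) :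
    tOp n c t X E s * sOp n c s 1 * tOp n c t X E s * sOp n c s 1 =
      sOp n c s 1 * tOp n c t X E s * sOp n c s 1 * tOp n c t X E s := by
  refine ext_vec fun j hj f => ?_
  simp only [Module.End.mul_apply]
  have hXt := LinearMap.congr_fun h.X_t.eq
  have hEX := LinearMap.congr_fun h.E_X
  have hEt := LinearMap.congr_fun h.E_t.eq
  have hEE := LinearMap.congr_fun h.E_E
  simp only [Module.End.mul_apply] at hXt hEX hEt hEE
  obtain rfl | rfl | hgt : j = 0 ∨ j = 1 ∨ 1 < j := by lia
  · simp (disch := lia) only [sOp_up, sOp_down, tOp_zero, tOp_pos, Nat.sub_self, map_add, map_sub,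
      map_smul, downWord, Module.End.one_apply, hXt, hEX, hEt, hEE]
    module
  · simp (disch := lia) only [sOp_up, sOp_down, tOp_zero, tOp_pos, Nat.sub_self, map_add, map_sub,
      map_smul, downWord, Module.End.one_apply, hXt, hEX, hEt, hEE]
    module
  · obtain ⟨k, rfl⟩ := Nat.exists_eq_add_of_le' hgt
    -- The off-diagonal entry is kept opaque: beyond linearity, only the identity of `offDiagonal`
    -- is used about it.
    obtain ⟨P, hP⟩ : ∃ P, P = X * downWord c s (k + 1) * (E - 1) := ⟨_, rfl⟩
    have hT (f : N) : tOp n c t X E s (vec R N n (k + 2) f) =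
        vec R N n (k + 2) (t f) + c • vec R N n 0 (P f) := by
      rw [tOp_pos f (by lia) hj, hP]; rfl
    have ho := h.offDiagonal hj
    rw [← hP] at ho
    have ho' (f : N) : P (s 1 (t f)) = t (P (s 1 f)) - c • X (E (P f)) :=
      eq_sub_of_add_eq (LinearMap.congr_fun ho f)
    have e := LinearMap.congr_fun (h.hecke.tau_sigma_one (by lia)) f
    have q := LinearMap.congr_fun (h.hecke.quadratic 1 le_rfl (by lia)) f
    simp only [Module.End.mul_apply, LinearMap.add_apply, LinearMap.smul_apply,
      Module.End.one_apply] at e q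
    have hT1 (f : N) : tOp n c t X E s (vec R N n 1 f) =
        vec R N n 1 (t f) + c • vec R N n 0 (X (E f) - X f) := by
      rw [tOp_pos f (by lia) hn, ← map_sub]; rfl
    have h0 (f : N) : sOp n c s 1 (vec R N n 0 f) = vec R N n 1 f + c • vec R N n 0 f :=
      sOp_up f rfl hn
    have h1 (f : N) : sOp n c s 1 (vec R N n 1 f) = vec R N n 0 f := sOp_down f rfl hn
    have h2 (f : N) : sOp n c s 1 (vec R N n (k + 2) f) = vec R N n (k + 2) (s 1 f) :=
      sOp_gt f (by lia) hj
    have hT0 (f : N) : tOp n c t X E s (vec R N n 0 f) = vec R N n 0 (X f) :=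
      tOp_zero f rfl (by lia)
    clear hP ho
    simp only [hT, hT0, hT1, h0, h1, h2, map_add, map_smul, e]
    simp only [ho', q, map_add, map_smul, map_sub]
    module

theorem aeval_tOp_zero (hn : 0 < n) (p : Polynomial R) (f : N) :
    Polynomial.aeval (tOp n c t X E s) p (vec R N n 0 f) =
      vec R N n 0 (Polynomial.aeval X p f) := by
  induction p using Polynomial.induction_on' with
  | add p q hp hq => simp only [map_add, LinearMap.add_apply, hp, hq]
  | monomial k r =>
    rw [← Polynomial.smul_X_eq_monomial]
    simp only [map_smul, map_pow, Polynomial.aeval_X, LinearMap.smul_apply]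
    congr 1
    induction k with
    | zero => rfl
    | succ k ih =>
      rw [pow_succ', pow_succ', Module.End.mul_apply, Module.End.mul_apply, ih,
        tOp_zero _ rfl hn]

/-- The operator is triangular with respect to positions `j` and 0. The correction by `g` removes
the off-diagonal entry: on the corrected vector `tOp` simply replaces `f`, `g` by `t f`, `t g`, and
the relation between `f` and `g` persists. -/
theorem aeval_tOp_pos (h : IsInducing n c t X E s) {j : ℕ} (hj : 0 < j) (hn : j < n)
    (p : Polynomial R) {f g : N} (hfg : E f - f = t g - X g) :
    Polynomial.aeval (tOp n c t X E s) p
        (vec R N n j f + c • vec R N n 0 (X (downWord c s (j - 1) g))) =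
      vec R N n j (Polynomial.aeval t p f) +
        c • vec R N n 0 (X (downWord c s (j - 1) (Polynomial.aeval t p g))) := by
  induction p using Polynomial.induction_on' with
  | add p q hp hq =>
    simp only [map_add, LinearMap.add_apply, smul_add] at hp hq ⊢
    rw [add_add_add_comm, hp, hq]; abel
  | monomial k r =>
    rw [← Polynomial.smul_X_eq_monomial]
    simp only [map_smul, map_pow, Polynomial.aeval_X, LinearMap.smul_apply]
    rw [smul_comm c r, ← smul_add]
    congr 1
    clear r
    have hXt := LinearMap.congr_fun h.X_t.eq
    have hEt := LinearMap.congr_fun h.E_t.eq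
    have hXD := LinearMap.congr_fun (h.X_downWord (k := j - 1) (by lia)).eq
    simp only [Module.End.mul_apply] at hXt hEt hXD
    have hk (k : ℕ) : E ((t ^ k) f) - (t ^ k) f = t ((t ^ k) g) - X ((t ^ k) g) := by
      induction k with
      | zero => exact hfg
      | succ k ih => simp only [pow_succ', Module.End.mul_apply, hEt, hXt, ← map_sub, ih]
    induction k with
    | zero => rfl
    | succ k ih =>
      rw [pow_succ', pow_succ', Module.End.mul_apply, ih, map_add, map_smul,
        tOp_pos _ hj hn, tOp_zero _ rfl (by lia), hk k]
      simp only [map_sub, smul_sub, Module.End.mul_apply, hXD]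
      abel

/-- Position 0 is killed because `p(X) = 0`. At `j > 0` the corrected vector is killed because `p(t)
= 0`, and the correction itself lies at position 0. -/
theorem aeval_tOp_eq_zero (h : IsInducing n c t X E s) {p : Polynomial R}
    (hX : Polynomial.aeval X p = 0) (ht : 1 < n → Polynomial.aeval t p = 0) :
    Polynomial.aeval (tOp n c t X E s) p = 0 := by
  refine ext_vec fun j hj f => ?_
  rcases Nat.eq_zero_or_pos j with rfl | h0
  · rw [aeval_tOp_zero hj, hX]; simp
  · obtain ⟨g, hg⟩ := h.div (by lia) f
    have e := h.aeval_tOp_pos h0 hj p hg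
    rw [map_add, map_smul, aeval_tOp_zero (by lia), hX, ht (by lia)] at e
    simpa using e

/-- The operators on the induced module satisfy the relations of `H(m,1,n)`. -/
theorem isHecke (h : IsInducing n c t X E s) : IsHecke c n (tOp n c t X E s) (sOp n c s) where
  braid _ h1 h2 := h.braid_op h1 h2
  far _ _ h1 h2 h3 := h.far_op h1 h2 h3
  tau_sigma_one h1 := h.tau_sigma_one_op h1
  tau_far _ h1 h2 := h.tau_far_op h1 h2
  quadratic _ h1 h2 := h.quadratic_op h1 h2

end IsInducing

end Induced

open scoped TensorProduct

/-! ### The operators on `R[X]/(f) ⊗ A`. -/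

section Concrete

variable {R A : Type*} [CommRing R] [Ring A] [Algebra R A]

/-- Left multiplications on `P ⊗ A` by elements of `A`. -/
noncomputable def leftMul (P : Type*) [CommRing P] [Algebra R P] :
    A →ₐ[R] Module.End R (P ⊗[R] A) :=
  (Algebra.lmul R (P ⊗[R] A)).comp Algebra.TensorProduct.includeRight

/-- The operator `p ⊗ a ↦ 1 ⊗ φ(p) a`. -/
noncomputable def evalOp {P : Type*} [CommRing P] [Algebra R P] (φ : P →ₐ[R] A) :
    Module.End R (P ⊗[R] A) :=
  Algebra.TensorProduct.includeRight.toLinearMap ∘ₗ LinearMap.mul' R A ∘ₗ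
    TensorProduct.map φ.toLinearMap LinearMap.id

section

variable {P : Type*} [CommRing P] [Algebra R P]

theorem leftMul_tmul (x a : A) (p : P) : leftMul (R := R) P x (p ⊗ₜ a) = p ⊗ₜ[R] (x * a) := by
  simp [leftMul]

theorem evalOp_tmul (φ : P →ₐ[R] A) (p : P) (a : A) :
    evalOp φ (p ⊗ₜ a) = (1 : P) ⊗ₜ[R] (φ p * a) := rfl

theorem lmul_tmul (p p' : P) (a : A) :
    Algebra.lmul R (P ⊗[R] A) (p ⊗ₜ 1) (p' ⊗ₜ a) = (p * p') ⊗ₜ[R] a := by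
  simp

theorem commute_lmul_leftMul (p : P) (x : A) :
    Commute (Algebra.lmul R (P ⊗[R] A) (p ⊗ₜ 1)) (leftMul P x) :=
  TensorProduct.ext' fun p' a => by simp [leftMul]

end

/-- Evaluation at a root `t` of `f`. -/
noncomputable def evalRoot (f : Polynomial R) (t : A) (ht : Polynomial.aeval t f = 0) :
    AdjoinRoot f →ₐ[R] A :=
  Ideal.Quotient.liftₐ (Ideal.span {f}) (Polynomial.aeval t) fun a ha => by
    obtain ⟨b, rfl⟩ := Ideal.mem_span_singleton'.1 ha
    rw [map_mul, ht, mul_zero]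

theorem evalRoot_mk (f p : Polynomial R) (t : A) (ht : Polynomial.aeval t f = 0) :
    evalRoot f t ht (AdjoinRoot.mk f p) = Polynomial.aeval t p := rfl

theorem evalRoot_root (f : Polynomial R) (t : A) (ht : Polynomial.aeval t f = 0) :
    evalRoot f t ht (AdjoinRoot.root f) = t := by
  rw [← AdjoinRoot.mk_X, evalRoot_mk, Polynomial.aeval_X]

/-- The operator of multiplication by the root on `R[X]/(f) ⊗ A`. -/
noncomputable def rootOp (A : Type*) [Ring A] [Algebra R A] (f : Polynomial R) :
    Module.End R (AdjoinRoot f ⊗[R] A) :=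
  Algebra.lmul R (AdjoinRoot f ⊗[R] A) (AdjoinRoot.root f ⊗ₜ 1)

theorem rootOp_tmul (f : Polynomial R) (p : AdjoinRoot f) (a : A) :
    rootOp A f (p ⊗ₜ a) = (AdjoinRoot.root f * p) ⊗ₜ[R] a :=
  lmul_tmul _ _ _

theorem rootOp_pow_tmul (f : Polynomial R) (p : AdjoinRoot f) (a : A) (k : ℕ) :
    (rootOp A f ^ k) (p ⊗ₜ a) = (AdjoinRoot.root f ^ k * p) ⊗ₜ[R] a := by
  induction k with
  | zero => simp
  | succ k ih => rw [pow_succ', Module.End.mul_apply, ih, rootOp_tmul, pow_succ', mul_assoc]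

theorem aeval_rootOp (A : Type*) [Ring A] [Algebra R A] (f : Polynomial R) :
    Polynomial.aeval (rootOp A f) f = 0 := by
  have e : rootOp A f = ((Algebra.lmul R (AdjoinRoot f ⊗[R] A)).comp
      Algebra.TensorProduct.includeLeft) (AdjoinRoot.root f) := rfl
  rw [e, Polynomial.aeval_algHom_apply, AdjoinRoot.aeval_eq, AdjoinRoot.mk_self, map_zero]

/-- Supplies the coefficient module. The second conclusion says that `E` fixes `1 ⊗ a`, so the
off-diagonal part of `τ` vanishes on such vectors. -/
theorem exists_isInducing {c : R} {n : ℕ} {t : A} {s : ℕ → A} (h : IsHecke c (n - 1) t s)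
    (f : Polynomial R) (ht : 1 < n → Polynomial.aeval t f = 0) :
    ∃ E : Module.End R (AdjoinRoot f ⊗[R] A),
      IsInducing n c (leftMul (AdjoinRoot f) t) (rootOp A f) E
        (fun i => leftMul (AdjoinRoot f) (s i)) ∧
      (1 < n → ∀ a, E (1 ⊗ₜ a) = 1 ⊗ₜ a) := by
  rcases Nat.lt_or_ge 1 n with hn | hn
  · refine ⟨evalOp (evalRoot f t (ht hn)), ?_, fun _ a => by rw [evalOp_tmul, map_one, one_mul]⟩
    set φ := evalRoot f t (ht hn) with hφ
    have hcomm (x : A) (hx : Commute t x) (p : AdjoinRoot f) : Commute (φ p) x := by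
      obtain ⟨p, rfl⟩ := AdjoinRoot.mk_surjective p
      rw [hφ, evalRoot_mk]
      induction p using Polynomial.induction_on' with
      | add p q hp hq => rw [map_add]; exact hp.add_left hq
      | monomial k r =>
        rw [← Polynomial.smul_X_eq_monomial, map_smul, map_pow, Polynomial.aeval_X]
        exact (hx.pow_left k).smul_left r
    have hE (x : A) (hx : Commute t x) : Commute (evalOp φ) (leftMul (AdjoinRoot f) x) :=
      TensorProduct.ext' fun p a => by
        simp only [Module.End.mul_apply, leftMul_tmul, evalOp_tmul, ← mul_assoc, (hcomm x hx p).eq]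
    exact
      { hecke := h.map _
        X_t := commute_lmul_leftMul _ _
        X_s := fun i _ _ => commute_lmul_leftMul _ _
        E_X := TensorProduct.ext' fun p a => by
          simp only [Module.End.mul_apply, leftMul_tmul, evalOp_tmul, rootOp_tmul, map_mul, hφ,
            evalRoot_root, mul_assoc]
        E_t := hE t (Commute.refl t)
        E_s := fun i h1 h2 => hE _ (h.tau_far i h1 (by lia))
        E_E := TensorProduct.ext' fun p a => by
          simp only [Module.End.mul_apply, evalOp_tmul, map_one, one_mul]
        E_s_E := fun i _ _ => TensorProduct.ext' fun p a => by
          simp only [Module.End.mul_apply, evalOp_tmul, leftMul_tmul, map_one, one_mul]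
        conj := fun h2 => TensorProduct.ext' fun p a => by
          obtain ⟨p, rfl⟩ := AdjoinRoot.mk_surjective p
          have e := congrArg (· * a) (h.tau_mul_conj (show 1 < n - 1 by lia) p)
          simp only [add_mul, sub_mul, smul_mul_assoc, mul_sub, one_mul, mul_one, mul_smul_comm,
            mul_assoc] at e
          simp only [Module.End.mul_apply, LinearMap.add_apply, LinearMap.sub_apply,
            LinearMap.smul_apply, Module.End.one_apply, evalOp_tmul, leftMul_tmul, hφ,
            evalRoot_mk, map_sub, map_smul]
          simp only [← TensorProduct.tmul_smul, ← TensorProduct.tmul_sub,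
            ← TensorProduct.tmul_add]
          rw [e]
        div := fun _ x => by
          induction x using TensorProduct.induction_on with
          | zero => exact ⟨0, by simp⟩
          | add x y hx hy =>
            obtain ⟨g, hg⟩ := hx
            obtain ⟨g', hg'⟩ := hy
            refine ⟨g + g', ?_⟩
            rw [map_add, map_add, map_add, add_sub_add_comm, hg, hg', add_sub_add_comm]
          | tmul p a =>
            obtain ⟨p, rfl⟩ := AdjoinRoot.mk_surjective p
            induction p using Polynomial.induction_on' with
            | add p q hp hq =>
              obtain ⟨g, hg⟩ := hp
              obtain ⟨g', hg'⟩ := hq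
              refine ⟨g + g', ?_⟩
              rw [map_add, TensorProduct.add_tmul, map_add, map_add, map_add, add_sub_add_comm, hg,
                hg', add_sub_add_comm]
            | monomial k r =>
              -- For `p = r X^k` the difference is `r (t^k - X^k)` applied to `1 ⊗ a`, and the
              -- geometric sum divides it by `t - X`.
              refine ⟨r • (∑ i ∈ Finset.range k, leftMul (AdjoinRoot f) t ^ i *
                rootOp A f ^ (k - 1 - i) : Module.End R _) (1 ⊗ₜ a), ?_⟩
              have e := LinearMap.congr_fun (Commute.mul_geom_sum₂
                (commute_lmul_leftMul (R := R) (AdjoinRoot.root f) t).symm k) (1 ⊗ₜ[R] a)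
              rw [map_smul, map_smul, ← smul_sub]
              refine Eq.trans ?_ (congrArg (r • ·) e.symm)
              rw [LinearMap.sub_apply, smul_sub]
              congr 1
              · rw [← map_pow, leftMul_tmul, evalOp_tmul, hφ, evalRoot_mk,
                  ← Polynomial.smul_X_eq_monomial, map_smul, map_pow, Polynomial.aeval_X,
                  smul_mul_assoc, TensorProduct.tmul_smul]
              · change _ = r • (rootOp A f ^ k) _
                rw [rootOp_pow_tmul, ← Polynomial.smul_X_eq_monomial, mul_one,
                  ← AdjoinRoot.smul_mk, map_pow, AdjoinRoot.mk_X, ← TensorProduct.smul_tmul'] }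
  -- For `n ≤ 1` no root `t` of `f` is given, so evaluation is unavailable; only position 0 can
  -- occur and `E` plays no role.
  · refine ⟨0, ?_, fun h => absurd h (by lia)⟩
    exact
      { hecke := h.map _
        X_t := commute_lmul_leftMul _ _
        X_s := fun i _ _ => commute_lmul_leftMul _ _
        E_X := by simp
        E_t := Commute.zero_left _
        E_s := fun i _ _ => Commute.zero_left _
        E_E := by simp
        E_s_E := by simp
        conj := by simp
        div := fun h => absurd h (by lia) }

end Concrete

/-! ### The normal forms span. -/

section Span

variable {R : Type*} [CommRing R] {m n : ℕ} {q : Rˣ} {v : Fin m → R}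

theorem sigmaInvDown_eq {j : ℕ} (hj : j < n) :
    sigmaInvDown m n q v j hj = downWord ((q : R) - ((q⁻¹ : Rˣ) : R)) (sg m n q v) j := by
  induction j with
  | zero => rfl
  | succ j ih => rw [sigmaInvDown, downWord, ih, sg_eq (by lia) hj]; rfl

theorem sigmaUp_eq {k : ℕ} (hk : k < n) : sigmaUp m n q v k hk = upWord (sg m n q v) k := by
  induction k with
  | zero => rfl
  | succ k ih => rw [sigmaUp, upWord, ih, sg_eq (by lia) hk]; rfl

theorem normalForm_eq (hn : 0 < n) (j : Fin n) (α : ℕ) (b : H m n q v) :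
    normalForm m n q v hn j α b =
      downWord ((q : R) - ((q⁻¹ : Rˣ) : R)) (sg m n q v) j * tg m n q v ^ α *
        upWord (sg m n q v) (n - 1) * b := by
  rw [normalForm, sigmaInvDown_eq, sigmaUp_eq, tg_eq hn]

theorem tg_mem_Wtilde (h : 1 < n) : tg m n q v ∈ Wtilde m n q v :=
  Algebra.subset_adjoin (Or.inl ⟨by lia, tg_eq (by lia)⟩)

theorem sg_mem_Wtilde {i : ℕ} (h1 : 1 ≤ i) (h2 : i + 1 < n) : sg m n q v i ∈ Wtilde m n q v :=
  Algebra.subset_adjoin (Or.inr ⟨i, h1, by lia, sg_eq h1 (by lia)⟩)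

variable (m n q v) in
/-- The homomorphism `H(m,1,n-1) → H(m,1,n)` given by the inclusion of generators. -/
noncomputable def inclH : H m (n - 1) q v →ₐ[R] H m n q v :=
  liftH ((isHecke_H m n q v).mono (Nat.sub_le n 1)) fun h => aeval_tg_charPoly (by lia)

/-- Provides lifts of elements of `W̃` to the smaller Hecke algebra. -/
theorem Wtilde_le_range : Wtilde m n q v ≤ (inclH m n q v).range := by
  refine Algebra.adjoin_le ?_
  rintro x (⟨h, rfl⟩ | ⟨i, h1, h2, rfl⟩)
  · exact ⟨tg m (n - 1) q v, by rw [← tg_eq]; exact liftH_tg _ _ h⟩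
  · refine ⟨sg m (n - 1) q v i, ?_⟩
    refine (liftH_sg _ _ h1 h2).trans (sg_eq h1 _)

variable (m n q v) in
/-- The span of the normal forms. -/
def normalSpan : Submodule R (H m n q v) :=
  Submodule.span R {x | ∃ j α b, j < n ∧ α < m ∧ b ∈ Wtilde m n q v ∧
    x = downWord ((q : R) - ((q⁻¹ : Rˣ) : R)) (sg m n q v) j * tg m n q v ^ α *
        upWord (sg m n q v) (n - 1) * b}

/-- Division by the monic polynomial `χ`, which kills `τ`, leaves only exponents below `m`. -/
theorem aeval_mem_normalSpan {j : ℕ} (hj : j < n) (p : Polynomial R) {b : H m n q v}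
    (hb : b ∈ Wtilde m n q v) :
    downWord ((q : R) - ((q⁻¹ : Rˣ) : R)) (sg m n q v) j * Polynomial.aeval (tg m n q v) p *
        upWord (sg m n q v) (n - 1) * b ∈ normalSpan m n q v := by
  rcases subsingleton_or_nontrivial R with hR | hR
  · have := Module.subsingleton R (H m n q v)
    rw [Subsingleton.elim (_ * b) 0]
    exact zero_mem _
  have hmod : Polynomial.aeval (tg m n q v) p =
      Polynomial.aeval (tg m n q v) (p %ₘ charPoly v) := by
    rw [Polynomial.aeval_modByMonic_eq_self_of_root (aeval_tg_charPoly (by lia))]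
  rw [hmod, Polynomial.aeval_eq_sum_range, Finset.mul_sum, Finset.sum_mul, Finset.sum_mul]
  refine Submodule.sum_mem _ fun α _ => ?_
  simp only [mul_smul_comm, smul_mul_assoc]
  rcases lt_or_ge α m with h | h
  · exact Submodule.smul_mem _ _ (Submodule.subset_span ⟨j, α, b, hj, h, hb, rfl⟩)
  · rw [Polynomial.coeff_eq_zero_of_degree_lt, zero_smul]
    · exact zero_mem _
    · refine (Polynomial.degree_modByMonic_lt p (charPoly_monic v)).trans_le ?_
      rw [Polynomial.degree_eq_natDegree (charPoly_monic v).ne_zero, charPoly_natDegree]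
      exact_mod_cast h

theorem pow_mem_normalSpan {j : ℕ} (hj : j < n) (α : ℕ) {b : H m n q v}
    (hb : b ∈ Wtilde m n q v) :
    downWord ((q : R) - ((q⁻¹ : Rˣ) : R)) (sg m n q v) j * tg m n q v ^ α *
        upWord (sg m n q v) (n - 1) * b ∈ normalSpan m n q v := by
  simpa using aeval_mem_normalSpan hj (Polynomial.X ^ α) hb

theorem sg_mul_mem_normalSpan {i : ℕ} (h1 : 1 ≤ i) (h2 : i < n) {x : H m n q v}
    (hx : x ∈ normalSpan m n q v) : sg m n q v i * x ∈ normalSpan m n q v := by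
  have h := isHecke_H m n q v
  induction hx using Submodule.span_induction with
  | zero => rw [mul_zero]; exact zero_mem _
  | add x y _ _ hx hy => rw [mul_add]; exact add_mem hx hy
  | smul r x _ hx => rw [mul_smul_comm]; exact Submodule.smul_mem _ r hx
  | mem x hx =>
    obtain ⟨j, α, b, hj, hα, hb, rfl⟩ := hx
    -- A letter `σ_{k+1}` standing before `τ^α` is absorbed into `b` as `σ_k`, which lies in `W̃`.
    have hpush (k : ℕ) (h3 : 1 ≤ k) (h4 : k + 1 < n) (w : H m n q v) :
        w * sg m n q v (k + 1) * tg m n q v ^ α * upWord (sg m n q v) (n - 1) * b =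
        w * tg m n q v ^ α * upWord (sg m n q v) (n - 1) * (sg m n q v k * b) := by
      have e1 := ((h.tau_far (k + 1) (by lia) h4).pow_left α).eq
      have e2 := h.mul_upWord h3 (show k < n - 1 by lia) (by lia)
      rw [mul_assoc w, ← e1, ← mul_assoc w, mul_assoc _ (sg m n q v (k + 1)), e2]
      simp only [mul_assoc]
    obtain hlt | rfl | rfl | hgt : j + 1 < i ∨ i = j + 1 ∨ j = i ∨ i < j := by lia
    · obtain ⟨i, rfl⟩ := Nat.exists_eq_add_of_le' h1
      rw [← mul_assoc, ← mul_assoc, ← mul_assoc, (h.far_downWord hlt h2).eq,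
        hpush i (by lia) h2]
      exact pow_mem_normalSpan hj α (mul_mem (sg_mem_Wtilde (by lia) h2) hb)
    · have e : sg m n q v (j + 1) = (sg m n q v (j + 1) - ((q : R) - ((q⁻¹ : Rˣ) : R)) • 1) +
          ((q : R) - ((q⁻¹ : Rˣ) : R)) • 1 := by rw [sub_add_cancel]
      rw [e, add_mul, smul_mul_assoc, one_mul]
      refine add_mem ?_ (Submodule.smul_mem _ _ (pow_mem_normalSpan hj α hb))
      have := pow_mem_normalSpan h2 α hb
      simpa only [downWord, mul_assoc] using this
    · obtain ⟨j, rfl⟩ := Nat.exists_eq_add_of_le' h1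
      rw [downWord, ← mul_assoc, ← mul_assoc, ← mul_assoc, ← mul_assoc, h.mul_inv h1 hj, one_mul]
      exact pow_mem_normalSpan (by lia) α hb
    · rw [← mul_assoc, ← mul_assoc, ← mul_assoc, h.mul_downWord h1 hgt hj, hpush i h1 (by lia)]
      exact pow_mem_normalSpan hj α (mul_mem (sg_mem_Wtilde h1 (by lia)) hb)

theorem downWord_mul_mem_normalSpan {k : ℕ} (hk : k < n) {x : H m n q v}
    (hx : x ∈ normalSpan m n q v) :
    downWord ((q : R) - ((q⁻¹ : Rˣ) : R)) (sg m n q v) k * x ∈ normalSpan m n q v := by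
  induction k with
  | zero => rwa [downWord, one_mul]
  | succ k ih =>
    have h := ih (by lia)
    rw [downWord, mul_assoc, sub_mul, smul_mul_assoc, one_mul]
    exact sub_mem (sg_mul_mem_normalSpan (by lia) hk h) (Submodule.smul_mem _ _ h)

theorem tg_mul_mem_normalSpan {x : H m n q v}
    (hx : x ∈ normalSpan m n q v) : tg m n q v * x ∈ normalSpan m n q v := by
  have h := isHecke_H m n q v
  induction hx using Submodule.span_induction with
  | zero => rw [mul_zero]; exact zero_mem _
  | add x y _ _ hx hy => rw [mul_add]; exact add_mem hx hy
  | smul r x _ hx => rw [mul_smul_comm]; exact Submodule.smul_mem _ r hx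
  | mem x hx =>
    obtain ⟨j, α, b, hj, hα, hb, rfl⟩ := hx
    rcases Nat.eq_zero_or_pos j with rfl | h0
    · have := pow_mem_normalSpan hj (α + 1) hb
      simpa only [downWord, one_mul, pow_succ', mul_assoc] using this
    · obtain ⟨k, rfl⟩ := Nat.exists_eq_add_of_le' h0
      obtain ⟨w, hw, hc⟩ := exists_downWord_eq ((q : R) - ((q⁻¹ : Rˣ) : R)) (sg m n q v) k
      obtain ⟨r, hr, hc'⟩ := exists_upWord_eq (sg m n q v) (n - 2)
      rw [show n - 2 + 1 = n - 1 by lia] at hr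
      have hwt := (hc _ fun i h1 h2 => h.tau_far i h1 (by lia)).eq
      have hrt := ((hc' _ fun i h1 h2 => h.tau_far i h1 (by lia)).pow_left α).eq
      have hrt' := (hc' _ fun i h1 h2 => h.tau_far i h1 (by lia)).eq
      have hK := h.tau_mul_conj (by lia) (Polynomial.X ^ α)
      rw [map_pow, Polynomial.aeval_X] at hK
      -- The words beginning with `w` are not normal forms, but they arise from the position 0 ones
      -- by multiplying with `σ_1` and then `σ_{k+1}⁻¹ ⋯ σ_1⁻¹`, under which the span is already
      -- stable.
      have hw' : w = downWord ((q : R) - ((q⁻¹ : Rˣ) : R)) (sg m n q v) (k + 1) * sg m n q v 1 := by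
        rw [hw, mul_assoc, h.inv_mul le_rfl (by lia), mul_one]
      have hmem (β : ℕ) {b : H m n q v} (hb : b ∈ Wtilde m n q v) :
          w * tg m n q v ^ β * upWord (sg m n q v) (n - 1) * b ∈ normalSpan m n q v := by
        have := downWord_mul_mem_normalSpan hj (sg_mul_mem_normalSpan le_rfl (by lia)
          (pow_mem_normalSpan (show 0 < n by lia) β hb))
        rw [hw']
        simpa only [downWord, one_mul, mul_assoc] using this
      have ht : tg m n q v ∈ Wtilde m n q v := tg_mem_Wtilde (by lia)
      have e1 := pow_mem_normalSpan hj α (mul_mem ht hb)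
      have e2 := hmem 1 (mul_mem (pow_mem ht α) hb)
      have e3 := hmem (α + 1) hb
      have key : tg m n q v * (downWord ((q : R) - ((q⁻¹ : Rˣ) : R)) (sg m n q v) (k + 1) *
            tg m n q v ^ α * upWord (sg m n q v) (n - 1) * b) =
          downWord ((q : R) - ((q⁻¹ : Rˣ) : R)) (sg m n q v) (k + 1) *
            tg m n q v ^ α * upWord (sg m n q v) (n - 1) * (tg m n q v * b) +
          ((q : R) - ((q⁻¹ : Rˣ) : R)) • (w * tg m n q v ^ 1 * upWord (sg m n q v) (n - 1) *
            (tg m n q v ^ α * b)) -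
          ((q : R) - ((q⁻¹ : Rˣ) : R)) • (w * tg m n q v ^ (α + 1) *
            upWord (sg m n q v) (n - 1) * b) := by
        rw [hw, hr, pow_one, pow_succ']
        generalize sg m n q v 1 - ((q : R) - ((q⁻¹ : Rˣ) : R)) • (1 : H m n q v) = y at hK ⊢
        generalize sg m n q v 1 = z at hK ⊢
        generalize (q : R) - ((q⁻¹ : Rˣ) : R) = c at hK ⊢
        calc tg m n q v * (w * y * tg m n q v ^ α * (z * r) * b)
            = (tg m n q v * w) * (y * tg m n q v ^ α * z) * r * b := by simp only [mul_assoc]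
          _ = w * (tg m n q v * y * tg m n q v ^ α * z) * r * b := by
            rw [hwt]; simp only [mul_assoc]
          _ = w * y * tg m n q v ^ α * z * (tg m n q v * r) * b +
              c • (w * tg m n q v * z * (tg m n q v ^ α * r) * b) -
              c • (w * (tg m n q v * tg m n q v ^ α) * (z * r) * b) := by
            rw [hK]
            simp only [mul_add, add_mul, mul_sub, sub_mul, mul_smul_comm, smul_mul_assoc, mul_assoc]
          _ = _ := by rw [hrt, hrt']; simp only [mul_assoc]
      rw [key]
      exact sub_mem (add_mem e1 (Submodule.smul_mem _ _ e2)) (Submodule.smul_mem _ _ e3)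

theorem normalSpan_eq_top (hn : 0 < n) : normalSpan m n q v = ⊤ := by
  have h1 : (1 : H m n q v) ∈ normalSpan m n q v := by
    have := pow_mem_normalSpan (show n - 1 < n by lia) 0 (one_mem (Wtilde m n q v))
    rwa [pow_zero, mul_one, mul_one, (isHecke_H m n q v).downWord_mul_upWord (by lia)] at this
  rw [eq_top_iff]
  rintro x -
  have hx : x ∈ Algebra.adjoin R
      ({x | 0 < n ∧ x = tg m n q v} ∪ {x | ∃ i, 1 ≤ i ∧ i < n ∧ x = sg m n q v i}) := by
    rw [adjoin_eq_top]; trivial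
  rw [← mul_one x]
  suffices ∀ y ∈ normalSpan m n q v, x * y ∈ normalSpan m n q v from this 1 h1
  induction hx using Algebra.adjoin_induction with
  | mem x hx =>
    rcases hx with ⟨-, rfl⟩ | ⟨i, h1, h2, rfl⟩
    · exact fun y hy => tg_mul_mem_normalSpan hy
    · exact fun y hy => sg_mul_mem_normalSpan h1 h2 hy
  | algebraMap r => exact fun y hy => by rw [← Algebra.smul_def]; exact Submodule.smul_mem _ _ hy
  | add a b _ _ ha hb => exact fun y hy => by rw [add_mul]; exact add_mem (ha y hy) (hb y hy)
  | mul a b _ _ ha hb => exact fun y hy => by rw [mul_assoc]; exact ha _ (hb y hy)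

end Span

/-! ### The normal forms are independent. -/

section Independence

section Action

variable {R N : Type*} [CommRing R] [AddCommGroup N] [Module R N] {n : ℕ} {c : R}
  {s : ℕ → Module.End R N}

theorem tOp_pow_vec {t X E : Module.End R N} (hn : 0 < n) (k : ℕ) (f : N) :
    (tOp n c t X E s ^ k) (vec R N n 0 f) = vec R N n 0 ((X ^ k) f) := by
  simpa using IsInducing.aeval_tOp_zero (E := E) (t := t) (c := c) (s := s) hn (Polynomial.X ^ k) f

end Action

/-- A basis of `P` identifies `P ⊗ M` with finitely supported families in `M`, so no flatness of `M`
is needed. -/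
theorem linearIndependent_single_tmul {R M P : Type*} [CommRing R] [AddCommGroup M] [Module R M]
    [AddCommGroup P] [Module R P] {n : ℕ} {κ ι : Type*} (b : Module.Basis κ R P) {w : ι → M}
    (hw : LinearIndependent R w) :
    LinearIndependent R fun p : Fin n × κ × ι =>
      Finsupp.single (M := P ⊗[R] M) p.1 (b p.2.1 ⊗ₜ w p.2.2) := by
  classical
  have h1 : LinearIndependent R fun p : κ × ι => b p.1 ⊗ₜ[R] w p.2 := by
    refine LinearIndependent.of_comp
      (TensorProduct.equivFinsuppOfBasisLeft (N := M) b).toLinearMap ?_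
    have h := (Finsupp.linearIndependent_single (R := R) (fun _ : κ => w) fun _ => hw).comp
      (fun p : κ × ι => (⟨p.1, p.2⟩ : Σ _ : κ, ι)) fun p p' h => by simpa [Prod.ext_iff] using h
    convert h using 1
    funext p
    ext i
    simp [TensorProduct.equivFinsuppOfBasisLeft_apply_tmul, Finsupp.single_apply]
  exact (Finsupp.linearIndependent_single (R := R) (fun _ : Fin n => _) fun _ => h1).comp
    (fun p : Fin n × κ × ι => (⟨p.1, p.2⟩ : Σ _ : Fin n, κ × ι))
    fun p p' h => by simpa [Prod.ext_iff] using h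

theorem linearIndependent_coe_basis {R A ι : Type*} [CommRing R] [Ring A] [Algebra R A]
    {S : Subalgebra R A} (B : Module.Basis ι R S) : LinearIndependent R fun i => (B i : A) :=
  B.linearIndependent.map' S.val.toLinearMap (LinearMap.ker_eq_bot_of_injective Subtype.val_injective)

theorem exists_basis_root_pow {R : Type*} [CommRing R] [Nontrivial R] {m : ℕ} (v : Fin m → R) :
    ∃ b : Module.Basis (Fin m) R (AdjoinRoot (charPoly v)),
      ∀ i, b i = AdjoinRoot.root (charPoly v) ^ (i : ℕ) := by
  have hdim : (AdjoinRoot.powerBasis' (charPoly_monic v)).dim = m := charPoly_natDegree v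
  refine ⟨(AdjoinRoot.powerBasis' (charPoly_monic v)).basis.reindex (finCongr hdim), fun i => ?_⟩
  rw [Module.Basis.reindex_apply, PowerBasis.basis_eq_pow, AdjoinRoot.powerBasis'_gen]
  rfl

variable {R : Type*} [CommRing R] {m n : ℕ} {q : Rˣ} {v : Fin m → R}

/-- The matrix coefficients that separate the normal forms. -/
theorem exists_linearMap_normalForm (hn : 0 < n) :
    ∃ L : H m n q v →ₗ[R] (Fin n →₀ AdjoinRoot (charPoly v) ⊗[R] H m n q v),
      ∀ (j : Fin n) (α : ℕ), ∀ b ∈ Wtilde m n q v, L (normalForm m n q v hn j α b) =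
        Finsupp.single j ((AdjoinRoot.root (charPoly v) ^ α) ⊗ₜ b) := by
  obtain ⟨E, hE, hE1⟩ := exists_isInducing (isHecke_H m (n - 1) q v) (charPoly v)
    fun h => aeval_tg_charPoly (by lia)
  set N := AdjoinRoot (charPoly v) ⊗[R] H m (n - 1) q v
  have hT := hE.aeval_tOp_eq_zero (aeval_rootOp _ (charPoly v)) fun h => by
    rw [Polynomial.aeval_algHom_apply, aeval_tg_charPoly (by lia), map_zero]
  have hH := hE.isHecke
  set ρ := liftH hH fun _ => hT with hρ
  have hρt := liftH_tg hH (fun _ => hT) hn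
  have hρs (i : ℕ) (h1 : 1 ≤ i) (h2 : i < n) := liftH_sg hH (fun _ => hT) h1 h2
  rw [← hρ] at hρt
  simp only [← hρ] at hρs
  have hup (k : ℕ) (hk : k < n) (f : N) :
      ρ (upWord (sg m n q v) k) (vec R N n k f) = vec R N n 0 f := by
    induction k with
    | zero => simp [upWord]
    | succ k ih =>
      rw [upWord, map_mul, Module.End.mul_apply, hρs _ (by lia) hk, sOp_down f rfl hk,
        Nat.add_sub_cancel, ih (by lia)]
  have hdown (k : ℕ) (hk : k < n) (f : N) :
      ρ (downWord ((q : R) - ((q⁻¹ : Rˣ) : R)) (sg m n q v) k) (vec R N n 0 f) =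
        vec R N n k f := by
    induction k with
    | zero => simp [downWord]
    | succ k ih =>
      rw [downWord, map_mul, Module.End.mul_apply, ih (by lia), map_sub, map_smul, map_one,
        hρs _ (by lia) hk, LinearMap.sub_apply, sOp_up f rfl hk]
      simp
  -- At the last position every `σ_i` of the smaller algebra has `i < n - 1` and acts by left
  -- multiplication; so does `τ`, because `E` fixes `1 ⊗ x`.
  have hincl (a : H m (n - 1) q v) : ∀ x, ρ (inclH m n q v a) (vec R N n (n - 1) (1 ⊗ₜ x)) =
      vec R N n (n - 1) (1 ⊗ₜ (a * x)) := by
    have ha : a ∈ Algebra.adjoin R ({x | 0 < n - 1 ∧ x = tg m (n - 1) q v} ∪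
        {x | ∃ i, 1 ≤ i ∧ i < n - 1 ∧ x = sg m (n - 1) q v i}) := by
      rw [adjoin_eq_top]; trivial
    induction ha using Algebra.adjoin_induction with
    | mem a ha =>
      intro x
      rcases ha with ⟨h, rfl⟩ | ⟨i, h1, h2, rfl⟩
      · rw [inclH, liftH_tg _ _ h, hρt, tOp_pos _ h (by lia), hE1 (by lia), sub_self, map_zero,
          map_zero, map_zero, smul_zero, add_zero, leftMul_tmul]
      · rw [inclH, liftH_sg _ _ h1 h2, hρs _ h1 (by lia), sOp_gt _ h2 (by lia), leftMul_tmul]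
    | algebraMap r =>
      intro x
      rw [AlgHom.commutes, AlgHom.commutes, Module.algebraMap_end_apply, ← Algebra.smul_def,
        TensorProduct.tmul_smul, map_smul]
    | add a b _ _ ha hb =>
      intro x
      rw [map_add, map_add, LinearMap.add_apply, ha, hb, add_mul, TensorProduct.tmul_add, map_add]
    | mul a b _ _ ha hb =>
      intro x
      rw [map_mul, map_mul, Module.End.mul_apply, hb, ha, mul_assoc]
  -- Act on `1 ⊗ 1` at the last position, then send the second tensor factor back to `H(m,1,n)`, so
  -- that the result depends on `b` and not on the chosen lift.
  refine ⟨Finsupp.mapRange.linearMap (TensorProduct.map LinearMap.id (inclH m n q v).toLinearMap) ∘ₗ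
    LinearMap.applyₗ (vec R N n (n - 1) (1 ⊗ₜ 1)) ∘ₗ ρ.toLinearMap, fun j α b hb => ?_⟩
  obtain ⟨a, rfl⟩ := Wtilde_le_range hb
  have e : ρ (normalForm m n q v hn j α (inclH m n q v a)) (vec R N n (n - 1) (1 ⊗ₜ 1)) =
      Finsupp.single j ((AdjoinRoot.root (charPoly v) ^ α) ⊗ₜ a) := by
    rw [normalForm_eq, map_mul, map_mul, map_mul, map_pow, Module.End.mul_apply,
      Module.End.mul_apply, Module.End.mul_apply, hincl, hup _ (by lia), hρt, tOp_pow_vec hn,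
      hdown _ j.isLt, rootOp_pow_tmul, mul_one, mul_one, vec, dif_pos j.isLt,
      Finsupp.lsingle_apply]
  change Finsupp.mapRange.linearMap _ (ρ (normalForm m n q v hn j α (inclH m n q v a))
    (vec R N n (n - 1) (1 ⊗ₜ 1))) = _
  rw [e]
  simp

end Independence

end CyclotomicHecke

/-! ### The basis theorem. -/

theorem mainTheorem3 {R : Type*} [CommRing R] [Algebra ℂ R] (m n : ℕ) (hm : 0 < m) (hn : 0 < n)
    (q : Rˣ) (v : Fin m → R) {ι : Type*}
    (B : Module.Basis ι R (CyclotomicHecke.Wtilde m n q v)) :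
    LinearIndependent R (fun p : Fin n × Fin m × ι =>
        CyclotomicHecke.normalForm m n q v hn p.1 (p.2.1 : ℕ)
          (B p.2.2 : CyclotomicHecke.H m n q v)) ∧
      Submodule.span R (Set.range (fun p : Fin n × Fin m × ι =>
        CyclotomicHecke.normalForm m n q v hn p.1 (p.2.1 : ℕ)
          (B p.2.2 : CyclotomicHecke.H m n q v))) = ⊤ := by
  constructor
  · rcases subsingleton_or_nontrivial R with hR | hR
    · exact Function.injective_of_subsingleton _
    obtain ⟨L, hL⟩ := CyclotomicHecke.exists_linearMap_normalForm (m := m) (q := q) (v := v) hn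
    refine LinearIndependent.of_comp L ?_
    obtain ⟨b, hb⟩ := CyclotomicHecke.exists_basis_root_pow v
    have hB := CyclotomicHecke.linearIndependent_coe_basis B
    have h := CyclotomicHecke.linearIndependent_single_tmul (n := n) b hB
    simp only [hb] at h
    have e : (L ∘ fun p : Fin n × Fin m × ι =>
        CyclotomicHecke.normalForm m n q v hn p.1 (p.2.1 : ℕ) (B p.2.2 : CyclotomicHecke.H m n q v))
        = _ := funext fun p => hL p.1 p.2.1 _ (B p.2.2).2
    rw [e]
    exact h
  · rw [eq_top_iff, ← CyclotomicHecke.normalSpan_eq_top hn, CyclotomicHecke.normalSpan,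
      Submodule.span_le]
    rintro x ⟨j, α, b, hj, hα, hb, rfl⟩
    rw [← CyclotomicHecke.normalForm_eq hn ⟨j, hj⟩]
    have hb' := B.mem_span ⟨b, hb⟩
    set S := Submodule.span R (Set.range fun p : Fin n × Fin m × ι =>
      CyclotomicHecke.normalForm m n q v hn p.1 (p.2.1 : ℕ) (B p.2.2 : CyclotomicHecke.H m n q v))
    suffices ∀ w ∈ Submodule.span R (Set.range B),
        CyclotomicHecke.normalForm m n q v hn ⟨j, hj⟩ α (w : CyclotomicHecke.H m n q v) ∈ S from
      this _ hb'
    intro w hw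
    induction hw using Submodule.span_induction with
    | mem w hw =>
      obtain ⟨i, rfl⟩ := hw
      exact Submodule.subset_span ⟨(⟨j, hj⟩, ⟨α, hα⟩, i), rfl⟩
    | zero => rw [CyclotomicHecke.normalForm, ZeroMemClass.coe_zero, mul_zero]; exact S.zero_mem
    | add a b _ _ ha hb =>
      rw [CyclotomicHecke.normalForm, Subalgebra.coe_add, mul_add]; exact S.add_mem ha hb
    | smul r a _ ha =>
      rw [CyclotomicHecke.normalForm, Subalgebra.coe_smul, mul_smul_comm]; exact S.smul_mem r ha
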